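/- **Setting.** Let $K$ be a field of characteristic zero and let $\mathcal F$ be the field of formal series $\sum_n a_n t^{\alpha_n}$ ($a_n\in K$, $\alpha_n\in\mathbb R$) such that only finitely many exponents lie below any given bound. The order $\|a\|$ of $a\neq 0$ is its smallest exponent, $\|0\|=\infty$, and $R=\{a:\|a\|\ge 0\}$. For $\mu\in\mathbb R^r$ put $D_\mu=\mathrm{diag}(t^{\mu_1},\dots,t^{\mu_r})$ and $\widehat\mu=(\mu_r,\dots,\mu_1)$. An $\mathbb R$-partition is a weakly decreasing $\mu\in\mathbb R^r$. For an $r\times r$ matrix $M$ over $\mathcal F$ with $\det M\ne0$, $inv(M)$ is the $\mathbb R$-partition $\mu$ with $PMQ^{-1}=D_\mu$ for some $P,Q\in GL_r(R)$. Pairs $(M,N)$ and $(PMQ^{-1},QNT^{-1})$ with $P,Q,T\in GL_r(R)$ are called equivalent. A matrix $Q\in GL_r(R)$ is $\mu$-admissible if $D_\mu QD_\mu^{-1}\in GL_r(R)$, and $T\in GL_r(R)$ is $\widehat\nu$-admissible if $D_{\widehat\nu}^{-1}TD_{\widehat\nu}\in GL_r(R)$. An index set of length $k$ is $I=(i_1<\dots<i_k)$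 in $\{1,\dots,r\}$; $I\le H$ means $i_s\le h_s$ for all $s$; $W_{IJ}$ is the minor of $W$ with rows $I$ and columns $J$; $|\mu_I|=\sum_s\mu_{i_s}$. **Generic matrices.** $A$ is *$\mu$-generic associated to $N$* if $A$ is upper triangular, $A=QNT^{-1}$ with $Q,T\in GL_r(R)$, where $Q$ is $\mu$-admissible and factors over $GL_r(R)$ both as upper times lower triangular and as lower times upper triangular, and for all index sets $I\le H\le J$ of equal length $$\|A_{IJ}\|\le\|A_{HJ}\|\le\|A_{IJ}\|+|\mu_I|-|\mu_H|,\qquad \|A_{IJ}\|\le\|A_{IH}\|.$$ A matrix $L\in GL_r(R)$ is *$\mu$-$\widehat\nu$-generic* if it is lower triangular, $L=Q_LQ_UST_UT_L$ with all factors in $GL_r(R)$, $Q_L,T_L$ lower and $Q_U,T_U$ upper triangular, $Q_LQ_U$ $\mu$-admissible and $T_UT_L$ $\widehat\nu$-admissible, and for all index sets of equal length $$\|L_{IJ}\|\le\|L_{HJ}\|\le\|L_{IJ}\|+|\mu_I|-|\mu_H|\quad(J\le I\le H),$$ $$\|L_{IJ}\|\le\|L_{IH}\|\le\|L_{IJ}\|+|\widehat\nu_J|-|\widehat\nu_H|\quad(H\le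 J\le I).$$ **Fillings.** The *right filling* of a pair $(M,N)$ is the array $\{k_{ij}\}_{1\le i\le j\le r}$ with $$k_{1j}+\dots+k_{ij}=\|((j-i)^\wedge,\dots,(j-1)^\wedge)\|-\|((j-i+1)^\wedge,\dots,j^\wedge)\|\qquad(1\le i\le j\le r),$$ where, for a $\mu$-generic matrix $A$ associated to some $N'$ with $(D_\mu,N')$ equivalent to $(M,N)$, $\|(p^\wedge,\dots,q^\wedge)\|$ is the order of the minor of $A$ that omits the rows numbered $p,\dots,q$ and uses the right-most columns. The *left filling* $\{m_{ij}\}$ of $(M,N)$ is the right filling of $(N^{T},M^{T})$. **Strips.** For sequences $\mu,\nu\in\mathbb R^r$ write $inv(\mu L\nu)=inv(D_\mu LD_{\widehat\nu})$; a shorter sequence is padded with zeros at the end. Row $j$ of $\lambda/\lambda'$ has length $\lambda_j-\lambda'_j$. The shape $\lambda/\lambda'$ is a *horizontal strip* if $\lambda'_j\le\lambda_j$ for all $j$ and $\lambda_{j'}\le\lambda'_j$ for $j<j'$. A strip $\mathcal S'$ is an *initial segment* of a strip $\mathcal S$ with the same inner shape if there is a row $j$ such that $\mathcal S$ and $\mathcal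 S'$ agree in all rows below $j$, $\mathcal S'$ is empty in all rows above $j$, and row $j$ of $\mathcal S'$ is at most as long as row $j$ of $\mathcal S$. **Ordering Lemma.** Let $\mu,\nu$ be $\mathbb R$-partitions of length $r$ and let $L$ be a $\mu$-$\widehat\nu$-generic matrix. (a) Let $\{k_{ij}\}$ be the right filling of $(D_\mu,LD_{\widehat\nu})$ and assume all $k_{ij}\ge0$. Then for each $1\le i\le r$ the $i$-strip of the filling is $inv(\mu L\nu_1,\dots,\nu_i)/inv(\mu L\nu_1,\dots,\nu_{i-1})$, i.e. row $j$ of this skew shape has length $k_{ij}$ for $j\ge i$ and $0$ for $j<i$; and whenever $0<\alpha<\beta\le\nu_i$, both $$inv(\mu L\nu_1,\dots,\nu_{i-1},\alpha)/inv(\mu L\nu_1,\dots,\nu_{i-1})\quad\text{and}\quad inv(\mu L\nu_1,\dots,\nu_{i-1},\beta)/inv(\mu L\nu_1,\dots,\nu_{i-1})$$ are horizontal strips, and the first is an initial segment of the second. That is, the $i$-strip grows from the bottom row upward, and from left to right, as the parameter grows from $0$ to $\nu_i$. (b) Likewise, let $\{m_{ij}\}$ be the left filling of $(D_\mu,LD_{\widehat\nu})$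 and assume all $m_{ij}\ge0$. Then for each $i$ the skew shape $inv(\mu_1,\dots,\mu_i\,L\nu)/inv(\mu_1,\dots,\mu_{i-1}\,L\nu)$ has row lengths $m_{ij}$ for $j\ge i$ and $0$ for $j<i$; and whenever $0<\alpha<\beta\le\mu_i$, the shapes $inv(\mu_1,\dots,\mu_{i-1},\alpha\,L\nu)/inv(\mu_1,\dots,\mu_{i-1}\,L\nu)$ and $inv(\mu_1,\dots,\mu_{i-1},\beta\,L\nu)/inv(\mu_1,\dots,\mu_{i-1}\,L\nu)$ are horizontal strips, and the first is an initial segment of the second. -/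

import Mathlib

namespace LRFill

/-! ### The field of real-exponent series with sparse exponents, and its valuation ring -/

section Field

variable (K : Type*) [Field K]

/-- A Hahn series with real exponents is sparse if only finitely many exponents lie below any
given bound; equivalently the exponents are bounded below and have no limit point. -/
def IsSparse {K : Type*} [Field K] (x : HahnSeries ℝ K) : Prop :=
  ∀ b : ℝ, (x.support ∩ Set.Iio b).Finite

theorem IsSparse.mono {K : Type*} [Field K] {x y : HahnSeries ℝ K} (h : x.support ⊆ y.support)
    (hy : IsSparse y) : IsSparse x := fun b =>
  (hy b).subset (Set.inter_subset_inter_left _ h)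

theorem isSparse_single {K : Type*} [Field K] (a : ℝ) (c : K) :
    IsSparse (HahnSeries.single a c) := fun _ =>
  ((Set.finite_singleton a).subset HahnSeries.support_single_subset).subset
    Set.inter_subset_left

theorem IsSparse.add {K : Type*} [Field K] {x y : HahnSeries ℝ K} (hx : IsSparse x)
    (hy : IsSparse y) : IsSparse (x + y) := fun b =>
  ((hx b).union (hy b)).subset (by
    rintro g ⟨hg, hb⟩
    rcases HahnSeries.support_add_subset _ _ hg with h | h
    · exact Or.inl ⟨h, hb⟩
    · exact Or.inr ⟨h, hb⟩)

theorem IsSparse.neg {K : Type*} [Field K] {x : HahnSeries ℝ K} (hx : IsSparse x) :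
    IsSparse (-x) := hx.mono (by rw [HahnSeries.support_neg])

theorem order_le_of_mem {K : Type*} [Field K] {x : HahnSeries ℝ K} {g : ℝ}
    (hg : g ∈ x.support) : x.order ≤ g := HahnSeries.order_le_of_coeff_ne_zero hg

theorem IsSparse.mul {K : Type*} [Field K] {x y : HahnSeries ℝ K} (hx : IsSparse x)
    (hy : IsSparse y) : IsSparse (x * y) := fun b =>
  ((hx (b - y.order)).image2 (· + ·) (hy (b - x.order))).subset (by
    rintro g ⟨hg, hb⟩
    obtain ⟨u, hu, v, hv, rfl⟩ := HahnSeries.support_mul_subset hg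
    have h1 := order_le_of_mem hu
    have h2 := order_le_of_mem hv
    simp only [Set.mem_Iio] at hb
    exact ⟨u, ⟨hu, by simp only [Set.mem_Iio]; linarith⟩,
      v, ⟨hv, by simp only [Set.mem_Iio]; linarith⟩, rfl⟩)

theorem IsSparse.inv {K : Type*} [Field K] {x : HahnSeries ℝ K} (hx : IsSparse x) :
    IsSparse x⁻¹ := by
  by_cases h0 : x = 0
  · subst h0; simpa using hx
  have hne : x⁻¹ ≠ 0 := inv_ne_zero h0
  have hxy : x * x⁻¹ = 1 := mul_inv_cancel₀ h0
  have hord : x⁻¹.order = -x.order := by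
    have := HahnSeries.order_mul h0 hne
    rw [hxy, HahnSeries.order_one] at this
    linarith
  -- every exponent of the inverse other than the lowest one comes from a smaller one
  have key : ∀ g ∈ x⁻¹.support, g ≠ -x.order →
      ∃ s ∈ x.support, ∃ h ∈ x⁻¹.support, x.order < s ∧ g = h + (s - x.order) := by
    intro g hg hgne
    by_contra! hcon
    have hc : (x * x⁻¹).coeff (x.order + g) = x.coeff x.order * x⁻¹.coeff g := by
      rw [HahnSeries.coeff_mul, Finset.sum_eq_single (x.order, g)]
      · rintro ⟨s, h⟩ hm hne'
        exfalso
        rw [Finset.mem_antidiagonal] at hm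
        obtain ⟨hs, hh, hsum⟩ := hm
        simp only at hs hh hsum
        rcases (order_le_of_mem hs).eq_or_lt with e | l
        · apply hne'
          have : h = g := by linarith
          rw [this, e]
        · exact hcon s hs h hh l (by linarith)
      · intro hm
        rw [Finset.mem_antidiagonal] at hm
        by_contra
        exact hm ⟨HahnSeries.coeff_order_eq_zero.not.2 h0, hg, rfl⟩
    rw [hxy, HahnSeries.coeff_one, if_neg (by intro e; apply hgne; linarith)] at hc
    exact mul_ne_zero (HahnSeries.coeff_order_eq_zero.not.2 h0) hg hc.symm
  -- a uniform positive lower bound for the steps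
  obtain ⟨δ, hδ, hstep⟩ : ∃ δ : ℝ, 0 < δ ∧ ∀ s ∈ x.support, x.order < s → x.order + δ ≤ s := by
    have hfin : ((x.support ∩ Set.Iio (x.order + 1)) \ {x.order}).Finite := (hx _).sdiff
    by_cases hemp : ((x.support ∩ Set.Iio (x.order + 1)) \ {x.order}).Nonempty
    · obtain ⟨m, hm, hmin⟩ := hfin.exists_minimal hemp
      have hmo : x.order < m := lt_of_le_of_ne (order_le_of_mem hm.1.1) (fun e => hm.2 e.symm)
      have hm1 : m < x.order + 1 := hm.1.2
      refine ⟨m - x.order, by linarith, fun s hs hso => ?_⟩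
      by_contra! hlt
      have hsm : s < m := by linarith
      have := hmin (y := s) ⟨⟨hs, by simp only [Set.mem_Iio]; linarith⟩, hso.ne'⟩ hsm.le
      exact absurd (this : m ≤ s) (not_le.2 hsm)
    · refine ⟨1, one_pos, fun s hs hso => ?_⟩
      by_contra! hlt
      exact hemp ⟨s, ⟨hs, hlt⟩, hso.ne'⟩
  have main : ∀ n : ℕ, (x⁻¹.support ∩ Set.Iio (-x.order + n * δ)).Finite := by
    intro n
    induction n with
    | zero =>
      refine Set.Finite.subset Set.finite_empty ?_
      rintro g ⟨hg, hb⟩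
      have := order_le_of_mem hg
      simp only [Nat.cast_zero, zero_mul, add_zero, Set.mem_Iio] at hb
      rw [hord] at this
      exact absurd hb (not_lt.2 this)
    | succ n ih =>
      refine ((Set.finite_singleton (-x.order)).union
        (ih.image2 (fun h s => h + (s - x.order)) (hx (x.order + (n + 1) * δ)))).subset ?_
      rintro g ⟨hg, hb⟩
      by_cases hgo : g = -x.order
      · exact Or.inl hgo
      obtain ⟨s, hs, h, hh, hso, rfl⟩ := key g hg hgo
      have h1 := hstep s hs hso
      have h2 := order_le_of_mem hh
      rw [hord] at h2
      simp only [Set.mem_Iio] at hb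
      push_cast at hb
      refine Or.inr ⟨h, ⟨hh, ?_⟩, s, ⟨hs, ?_⟩, rfl⟩
      · simp only [Set.mem_Iio]; linarith
      · simp only [Set.mem_Iio]; linarith
  intro b
  obtain ⟨n, hn⟩ := exists_nat_gt ((b + x.order) / δ)
  rw [div_lt_iff₀ hδ] at hn
  refine (main n).subset (Set.inter_subset_inter_right _ (Set.Iio_subset_Iio ?_))
  linarith

/-- The field of formal series in `t` over `K` with sparse real exponents. -/
def SparseField : Subfield (HahnSeries ℝ K) where
  carrier := {x | IsSparse x}
  mul_mem' := IsSparse.mul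
  one_mem' := isSparse_single 0 1
  add_mem' := IsSparse.add
  zero_mem' := by intro b; simp
  neg_mem' := IsSparse.neg
  inv_mem' := fun _ h => IsSparse.inv h

end Field

variable {K : Type*} [Field K]

/-- The order of a series: its smallest exponent, and `⊤` for the zero series. -/
noncomputable def ord (a : SparseField K) : WithTop ℝ := (a : HahnSeries ℝ K).orderTop

/-- The power `t ^ s` of the variable. -/
noncomputable def tPow (K : Type*) [Field K] (s : ℝ) : SparseField K :=
  ⟨HahnSeries.single s 1, isSparse_single s 1⟩

/-- The valuation ring of series of non-negative order. -/
def ValRing (K : Type*) [Field K] : Subring (SparseField K) where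
  carrier := {a | 0 ≤ ord a}
  mul_mem' := by
    intro a b ha hb
    have h : ord (a * b) = ord a + ord b := HahnSeries.orderTop_mul _ _
    change 0 ≤ ord (a * b)
    rw [h]
    exact add_nonneg ha hb
  one_mem' := by
    change (0 : WithTop ℝ) ≤ (1 : HahnSeries ℝ K).orderTop
    rw [HahnSeries.orderTop_one]
  add_mem' := by
    intro a b ha hb
    have h : min (ord a) (ord b) ≤ ord (a + b) := HahnSeries.min_orderTop_le_orderTop_add
    exact le_trans (le_min ha hb) h
  zero_mem' := by
    change (0 : WithTop ℝ) ≤ (0 : HahnSeries ℝ K).orderTop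
    simp
  neg_mem' := by
    intro a ha
    change (0 : WithTop ℝ) ≤ (-(a : HahnSeries ℝ K)).orderTop
    rw [HahnSeries.orderTop_neg]
    exact ha

/-! ### Matrices -/

variable {r : ℕ}

/-- An invertible matrix over the valuation ring, viewed over the field. -/
def toF (P : GL (Fin r) (ValRing K)) : Matrix (Fin r) (Fin r) (SparseField K) :=
  P.val.map (fun a => (a : SparseField K))

/-- `D_μ = diag(t ^ μ₁, …, t ^ μ_r)`. -/
noncomputable def D (K : Type*) [Field K] (μ : Fin r → ℝ) :
    Matrix (Fin r) (Fin r) (SparseField K) :=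
  Matrix.diagonal (fun i => tPow K (μ i))

/-- The reversed sequence `(ν_r, …, ν₁)`. -/
def hat (ν : Fin r → ℝ) : Fin r → ℝ := fun i => ν i.rev

/-- `μ` is an invariant partition of `M`: it is weakly decreasing and `P M Q⁻¹ = D_μ` for some
`P`, `Q` invertible over the valuation ring. -/
def HasInv (M : Matrix (Fin r) (Fin r) (SparseField K)) (μ : Fin r → ℝ) : Prop :=
  Antitone μ ∧ ∃ P Q : GL (Fin r) (ValRing K), toF P * M * toF Q⁻¹ = D K μ

/-- The invariant partition of `M` (it exists and is unique when `det M ≠ 0`). -/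
noncomputable def inv (M : Matrix (Fin r) (Fin r) (SparseField K)) : Fin r → ℝ :=
  Classical.epsilon (HasInv M)

def IsUpper {R : Type*} [Zero R] (A : Matrix (Fin r) (Fin r) R) : Prop :=
  ∀ i j, j < i → A i j = 0

def IsLower {R : Type*} [Zero R] (A : Matrix (Fin r) (Fin r) R) : Prop :=
  ∀ i j, i < j → A i j = 0

/-- `(M, N)` is pair equivalent to `(A, B)`. -/
def PairEquiv (M N A B : Matrix (Fin r) (Fin r) (SparseField K)) : Prop :=
  ∃ P Q T : GL (Fin r) (ValRing K), A = toF P * M * toF Q⁻¹ ∧ B = toF Q * N * toF T⁻¹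

/-- `Q` is `μ`-admissible: `D_μ Q D_μ⁻¹` is invertible over the valuation ring. -/
def IsLeftAdmissible (μ : Fin r → ℝ) (Q : GL (Fin r) (ValRing K)) : Prop :=
  ∃ P : GL (Fin r) (ValRing K), toF P = D K μ * toF Q * (D K μ)⁻¹

/-- `T` is `ν̂`-admissible: `D_ν̂⁻¹ T D_ν̂` is invertible over the valuation ring. -/
def IsRightAdmissible (ν : Fin r → ℝ) (T : GL (Fin r) (ValRing K)) : Prop :=
  ∃ P : GL (Fin r) (ValRing K), toF P = (D K (hat ν))⁻¹ * toF T * D K (hat ν)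

/-- The minor of `W` with rows `I` and columns `J`. Index sets of length `k` are strictly
increasing maps `Fin k ↪o Fin r`. -/
noncomputable def minor {k : ℕ} (W : Matrix (Fin r) (Fin r) (SparseField K))
    (I J : Fin k ↪o Fin r) : SparseField K :=
  (W.submatrix I J).det

/-- The order on index sets of length `k`: `i_s ≤ h_s` for all `s`. -/
def IdxLE {k : ℕ} (I H : Fin k ↪o Fin r) : Prop := ∀ s, I s ≤ H s

/-- `|μ_I|`. -/
def wt {k : ℕ} (μ : Fin r → ℝ) (I : Fin k ↪o Fin r) : ℝ := ∑ s, μ (I s)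

/-! ### Generic matrices -/

/-- `A` is a `μ`-generic matrix associated to `N`. -/
structure IsMuGeneric (μ : Fin r → ℝ) (N A : Matrix (Fin r) (Fin r) (SparseField K)) : Prop where
  upper : IsUpper A
  factor : ∃ Q T QU QL QL' QU' : GL (Fin r) (ValRing K),
    A = toF Q * N * toF T⁻¹ ∧ IsLeftAdmissible μ Q ∧
    Q = QU * QL ∧ Q = QL' * QU' ∧
    IsUpper QU.val ∧ IsLower QL.val ∧ IsLower QL'.val ∧ IsUpper QU'.val
  row : ∀ (k : ℕ) (I H J : Fin k ↪o Fin r), IdxLE I H → IdxLE H J →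
    ord (minor A I J) ≤ ord (minor A H J)
  gap : ∀ (k : ℕ) (I H J : Fin k ↪o Fin r), IdxLE I H → IdxLE H J →
    ord (minor A H J) ≤ ord (minor A I J) + ((wt μ I - wt μ H : ℝ) : WithTop ℝ)
  col : ∀ (k : ℕ) (I H J : Fin k ↪o Fin r), IdxLE I H → IdxLE H J →
    ord (minor A I J) ≤ ord (minor A I H)

/-- `L` is a `μ`-`ν̂`-generic matrix. As `L` is lower triangular, its minor with rows `I` and
columns `J` can be non-zero only if `IdxLE J I`; the inequalities range over these minors. -/
structure IsMuNuGeneric (μ ν : Fin r → ℝ) (L : GL (Fin r) (ValRing K)) : Prop where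
  lower : IsLower L.val
  factor : ∃ QL QU S TU TL : GL (Fin r) (ValRing K),
    L = QL * QU * S * TU * TL ∧
    IsLeftAdmissible μ (QL * QU) ∧ IsRightAdmissible ν (TU * TL) ∧
    IsLower QL.val ∧ IsUpper QU.val ∧ IsUpper TU.val ∧ IsLower TL.val
  row : ∀ (k : ℕ) (I H J : Fin k ↪o Fin r), IdxLE J I → IdxLE I H →
    ord (minor (toF L) I J) ≤ ord (minor (toF L) H J)
  rowGap : ∀ (k : ℕ) (I H J : Fin k ↪o Fin r), IdxLE J I → IdxLE I H →
    ord (minor (toF L) H J) ≤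
      ord (minor (toF L) I J) + ((wt μ I - wt μ H : ℝ) : WithTop ℝ)
  col : ∀ (k : ℕ) (I H J : Fin k ↪o Fin r), IdxLE H J → IdxLE J I →
    ord (minor (toF L) I J) ≤ ord (minor (toF L) I H)
  colGap : ∀ (k : ℕ) (I H J : Fin k ↪o Fin r), IdxLE H J → IdxLE J I →
    ord (minor (toF L) I H) ≤
      ord (minor (toF L) I J) + ((wt (hat ν) J - wt (hat ν) H : ℝ) : WithTop ℝ)

/-! ### The filling of a pair -/

/-- The right-most `k` columns, for `k ≤ r`. -/
def lastCols {k : ℕ} (hk : k ≤ r) : Fin k ↪o Fin r :=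
  (Fin.natAddOrderEmb (r - k)).trans (Fin.castOrderIso (Nat.sub_add_cancel hk)).toOrderEmbedding

/-- All rows except those with (one-based) number from `p` to `q`. -/
def keptRows (r p q : ℕ) : Finset (Fin r) :=
  Finset.univ.filter (fun s => ¬ (p ≤ s.val + 1 ∧ s.val + 1 ≤ q))

/-- The order `‖(p^, …, q^)‖` of the minor of `A` in which the rows numbered `p, …, q`
(one-based) are omitted and the right-most columns are used. -/
noncomputable def omitOrd (A : Matrix (Fin r) (Fin r) (SparseField K)) (p q : ℕ) : ℝ :=
  (minor A ((keptRows r p q).orderEmbOfFin rfl)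
    (lastCols ((Finset.card_le_univ _).trans_eq (Fintype.card_fin r))) : HahnSeries ℝ K).order

/-- The sum `k_{1j} + ⋯ + k_{ij}` determined by the `μ`-generic matrix `A`
(one-based `i ≤ j`). -/
noncomputable def partSum (A : Matrix (Fin r) (Fin r) (SparseField K)) (i j : ℕ) : ℝ :=
  omitOrd A (j - i) (j - 1) - omitOrd A (j - i + 1) j

/-- `k` is the right filling of the pair `(M, N)`: `k i j`, for `i ≤ j`, is the part `k_{i+1,j+1}`
computed from a `μ`-generic pair `(D_μ, A)` in the orbit of `(M, N)`. -/
def IsRightFilling (M N : Matrix (Fin r) (Fin r) (SparseField K)) (k : Fin r → Fin r → ℝ) :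
    Prop :=
  ∃ (μ : Fin r → ℝ) (N' A : Matrix (Fin r) (Fin r) (SparseField K)),
    Antitone μ ∧ PairEquiv M N (D K μ) N' ∧ IsMuGeneric μ N' A ∧
    ∀ i j : Fin r, i ≤ j →
      k i j = partSum A (i.val + 1) (j.val + 1) - partSum A i.val (j.val + 1)

/-- `m` is the left filling of `(M, N)`: the same construction, with the roles of `M` and `N` and
of rows and columns interchanged. -/
def IsLeftFilling (M N : Matrix (Fin r) (Fin r) (SparseField K)) (m : Fin r → Fin r → ℝ) :
    Prop :=
  IsRightFilling N.transpose M.transpose m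

/-! ### Strips -/

/-- With `i` the zero-based position of `ν_i`: the sequence `(ν₁, …, ν_{i-1}, 0, …, 0)`. -/
def before (ν : Fin r → ℝ) (i : Fin r) : Fin r → ℝ := fun s => if s < i then ν s else 0

/-- The sequence `(ν₁, …, ν_{i-1}, a, 0, …, 0)`. -/
def beforeThen (ν : Fin r → ℝ) (i : Fin r) (a : ℝ) : Fin r → ℝ :=
  Function.update (before ν i) i a

/-- The invariant partition `inv(μ L ν) = inv(D_μ L D_ν̂)`. -/
noncomputable def shape (μ : Fin r → ℝ) (L : GL (Fin r) (ValRing K)) (ν : Fin r → ℝ) :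
    Fin r → ℝ :=
  inv (D K μ * toF L * D K (hat ν))

/-- The skew shape `lam / lam'` is a horizontal strip. -/
def IsHorizontalStrip (lam lam' : Fin r → ℝ) : Prop :=
  (∀ j, lam' j ≤ lam j) ∧ ∀ j j', j < j' → lam j' ≤ lam' j

/-- `lam₁ / lam'` is an initial segment of `lam₂ / lam'`. -/
def IsInitialSegment (lam₁ lam₂ lam' : Fin r → ℝ) : Prop :=
  ∃ j : Fin r,
    (∀ j', j < j' → lam₁ j' - lam' j' = lam₂ j' - lam' j') ∧
    (∀ j', j' < j → lam₁ j' - lam' j' = 0) ∧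
    lam₁ j - lam' j ≤ lam₂ j - lam' j

end LRFill

/-! The last k parts of `inv M` add up to the least order of a k×k minor of M. So the shapes are
known once the least orders of the minors of D_μ L D_w are known, where w = (0,…,0,α,ν_{i-1},…,ν_1).
Genericity of L locates the minimum. The row gap inequality moves the rows to the last k. The column
inequalities then single out the first k columns if these reach the position of α. Otherwise two
blocks of k consecutive columns compete: one ending just before that position, of weight 0, and one
ending at it, of weight α. Hence raising the parameter from 0 to α raises the sum of the parts from
row j downward by min(g_j, α), where g_j (`growthBound`) is ν_i for j ≤ i and otherwise a difference
of orders of two minors of L. Row j therefore gains min(g_j, α) − min(g_{j+1}, α).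

The filling is governed by the same numbers. Lower bounds for minors that depend on the row set and
satisfy the monotonicity and gap inequalities survive admissible transformations
(`le_ord_minor_of_admissible`, which rests on a rearrangement inequality). Used in both directions,
this matches the right-column minors of A with the left-column minors of L D_ν̂, and k_ij = g_j −
g_{j+1} follows (`rightFilling_eq`). Nonnegativity of the filling thus says that g is weakly
decreasing, and the truncated differences fill up from the bottom row.

The interlacing half of the strip condition is independent of genericity: changing α rescales a
single column, and a dimension count applies (`HasInv.interlace`). Part (b) is part (a) for the
reflection of L in its antidiagonal, with μ and ν exchanged. -/

namespace LRFill

variable {K : Type*} [Field K] {r : ℕ}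

/-! ### The order function -/

theorem ord_zero : ord (0 : SparseField K) = ⊤ := HahnSeries.orderTop_zero

theorem ord_eq_top {a : SparseField K} : ord a = ⊤ ↔ a = 0 := by
  unfold ord
  rw [HahnSeries.orderTop_eq_top]
  exact ZeroMemClass.coe_eq_zero

theorem ord_one : ord (1 : SparseField K) = 0 := HahnSeries.orderTop_one

theorem ord_mul (a b : SparseField K) : ord (a * b) = ord a + ord b :=
  HahnSeries.orderTop_mul _ _

theorem ord_neg (a : SparseField K) : ord (-a) = ord a := HahnSeries.orderTop_neg

theorem ord_tPow (s : ℝ) : ord (tPow K s) = (s : WithTop ℝ) :=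
  HahnSeries.orderTop_single one_ne_zero

theorem min_ord_le_ord_add (a b : SparseField K) : min (ord a) (ord b) ≤ ord (a + b) :=
  HahnSeries.min_orderTop_le_orderTop_add

theorem le_ord_sum {ι : Type*} (s : Finset ι) (f : ι → SparseField K) (c : WithTop ℝ)
    (h : ∀ i ∈ s, c ≤ ord (f i)) : c ≤ ord (∑ i ∈ s, f i) := by
  classical
  induction s using Finset.induction_on with
  | empty => simp [ord_zero]
  | insert a s ha ih =>
    rw [Finset.sum_insert ha]
    exact le_trans (le_min (h a (Finset.mem_insert_self _ _))
      (ih fun i hi => h i (Finset.mem_insert_of_mem hi))) (min_ord_le_ord_add _ _)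

theorem ord_prod {ι : Type*} (s : Finset ι) (f : ι → SparseField K) :
    ord (∏ i ∈ s, f i) = ∑ i ∈ s, ord (f i) := by
  classical
  induction s using Finset.induction_on with
  | empty => simp [ord_one]
  | insert a s ha ih => rw [Finset.prod_insert ha, Finset.sum_insert ha, ord_mul, ih]

theorem ord_sign_smul {n : ℕ} (σ : Equiv.Perm (Fin n)) (a : SparseField K) :
    ord (((Equiv.Perm.sign σ : ℤˣ) : ℤ) * a : SparseField K) = ord a := by
  rcases Int.units_eq_one_or (Equiv.Perm.sign σ) with h | h <;> simp [h, ord_neg]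

theorem coe_order {a : SparseField K} (ha : a ≠ 0) :
    (((a : HahnSeries ℝ K).order : ℝ) : WithTop ℝ) = ord a :=
  HahnSeries.order_eq_orderTop_of_ne_zero (by simpa using ha)

theorem order_eq_of_ord_eq {a : SparseField K} {c : ℝ} (h : ord a = c) :
    (a : HahnSeries ℝ K).order = c := by
  have ha : a ≠ 0 := by
    rintro rfl
    rw [ord_zero] at h
    exact WithTop.top_ne_coe h
  exact WithTop.coe_injective ((coe_order ha).trans h)

theorem tPow_mul_tPow (s u : ℝ) : tPow K s * tPow K u = tPow K (s + u) := by
  apply Subtype.ext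
  change HahnSeries.single s (1 : K) * HahnSeries.single u 1 = HahnSeries.single (s + u) 1
  rw [HahnSeries.single_mul_single, one_mul]

theorem tPow_zero : tPow K 0 = 1 := rfl

theorem tPow_ne_zero (s : ℝ) : tPow K s ≠ 0 := by
  rw [Ne, ← ord_eq_top, ord_tPow]
  exact WithTop.coe_ne_top

theorem inv_tPow (s : ℝ) : (tPow K s)⁻¹ = tPow K (-s) := by
  rw [inv_eq_iff_eq_inv, eq_comm, inv_eq_of_mul_eq_one_left]
  rw [tPow_mul_tPow, add_neg_cancel, tPow_zero]

/-! ### Matrices over the valuation ring -/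

theorem toF_eq (P : GL (Fin r) (ValRing K)) : toF P = (ValRing K).subtype.mapMatrix P.val := rfl

theorem toF_mul (P Q : GL (Fin r) (ValRing K)) : toF (P * Q) = toF P * toF Q := by
  rw [toF_eq, toF_eq, toF_eq, Units.val_mul, map_mul]

theorem toF_one : toF (1 : GL (Fin r) (ValRing K)) = 1 := by
  rw [toF_eq, Units.val_one, map_one]

theorem toF_mul_inv (P : GL (Fin r) (ValRing K)) : toF P * toF P⁻¹ = 1 := by
  rw [← toF_mul, mul_inv_cancel, toF_one]

theorem toF_inv_mul (P : GL (Fin r) (ValRing K)) : toF P⁻¹ * toF P = 1 := by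
  rw [← toF_mul, inv_mul_cancel, toF_one]

theorem ord_toF_nonneg (P : GL (Fin r) (ValRing K)) (i j : Fin r) : 0 ≤ ord (toF P i j) :=
  (P.val i j).2

theorem det_toF_ne_zero (P : GL (Fin r) (ValRing K)) : (toF P).det ≠ 0 := by
  intro h
  have := congrArg Matrix.det (toF_mul_inv P)
  rw [Matrix.det_mul, h, zero_mul, Matrix.det_one] at this
  exact zero_ne_one this

theorem D_mul_D_neg (μ : Fin r → ℝ) : D K μ * D K (-μ) = 1 := by
  rw [D, D, Matrix.diagonal_mul_diagonal, ← Matrix.diagonal_one]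
  congr 1
  funext i
  rw [tPow_mul_tPow, Pi.neg_apply, add_neg_cancel, tPow_zero]

theorem D_inv (μ : Fin r → ℝ) : (D K μ)⁻¹ = D K (-μ) :=
  Matrix.inv_eq_right_inv (D_mul_D_neg μ)

theorem D_neg_mul_D (μ : Fin r → ℝ) : D K (-μ) * D K μ = 1 := by
  have := D_mul_D_neg (K := K) (-μ)
  rwa [neg_neg] at this

theorem det_D_ne_zero (μ : Fin r → ℝ) : (D K μ).det ≠ 0 := by
  rw [D, Matrix.det_diagonal]
  exact Finset.prod_ne_zero_iff.2 fun i _ => tPow_ne_zero _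

/-! ### Minors of products -/

/-- Multilinearity in the rows: each row of the product is a combination of rows of `Y`. The sum is
not grouped into Cauchy–Binet form, since only lower bounds on orders are drawn from it. -/
theorem det_submatrix_mul {k : ℕ} (X Y : Matrix (Fin r) (Fin r) (SparseField K))
    (f g : Fin k → Fin r) : ((X * Y).submatrix f g).det =
      ∑ h : Fin k → Fin r, (∏ s, X (f s) (h s)) * (Y.submatrix h g).det := by
  have e : (X * Y).submatrix f g = fun s => ∑ q : Fin r, X (f s) q • fun t => Y q (g t) := by
    funext s t
    rw [Finset.sum_apply]
    simp [Matrix.mul_apply]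
  have h1 := (Matrix.detRowAlternating (n := Fin k) (R := SparseField K)).toMultilinearMap.map_sum
    (fun (s : Fin k) (q : Fin r) => X (f s) q • fun t : Fin k => Y q (g t))
  rw [e]
  refine h1.trans (Finset.sum_congr rfl fun h _ => ?_)
  exact (Matrix.detRowAlternating (n := Fin k) (R := SparseField K)).toMultilinearMap.map_smul_univ
    (fun s => X (f s) (h s)) (fun s t => Y (h s) (g t))

theorem le_ord_det_submatrix_mul {k : ℕ} (X Y : Matrix (Fin r) (Fin r) (SparseField K))
    (f g : Fin k → Fin r) (c : WithTop ℝ)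
    (H : ∀ h : Fin k → Fin r, Function.Injective h →
      c ≤ ∑ s, ord (X (f s) (h s)) + ord (Y.submatrix h g).det) :
    c ≤ ord ((X * Y).submatrix f g).det := by
  rw [det_submatrix_mul]
  refine le_ord_sum _ _ _ fun h _ => ?_
  rw [ord_mul, ord_prod]
  by_cases hi : Function.Injective h
  · exact H h hi
  · rw [Function.not_injective_iff] at hi
    obtain ⟨a, b, hab, hne⟩ := hi
    rw [Matrix.det_zero_of_row_eq hne (by funext t; simp [hab]), ord_zero, WithTop.add_top]
    exact le_top

theorem le_ord_det_integral_mul {k : ℕ} (X Y : Matrix (Fin r) (Fin r) (SparseField K))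
    (hX : ∀ i j, 0 ≤ ord (X i j)) (g : Fin k → Fin r) (c : WithTop ℝ)
    (H : ∀ f : Fin k → Fin r, c ≤ ord (Y.submatrix f g).det) (f : Fin k → Fin r) :
    c ≤ ord ((X * Y).submatrix f g).det :=
  le_ord_det_submatrix_mul X Y f g c fun h _ =>
    le_add_of_nonneg_of_le (Finset.sum_nonneg fun _ _ => hX _ _) (H h)

theorem le_ord_det_mul_integral {k : ℕ} (X Y : Matrix (Fin r) (Fin r) (SparseField K))
    (hY : ∀ i j, 0 ≤ ord (Y i j)) (f : Fin k → Fin r) (c : WithTop ℝ)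
    (H : ∀ g : Fin k → Fin r, c ≤ ord (X.submatrix f g).det) (g : Fin k → Fin r) :
    c ≤ ord ((X * Y).submatrix f g).det := by
  rw [← Matrix.det_transpose, Matrix.transpose_submatrix, Matrix.transpose_mul]
  refine le_ord_det_integral_mul _ _ (fun i j => hY j i) f c (fun g => ?_) g
  rw [← Matrix.transpose_submatrix, Matrix.det_transpose]
  exact H g

/-- Every injective map out of `Fin k` is an increasing one up to a permutation. -/
theorem exists_orderEmb_perm {k : ℕ} (h : Fin k → Fin r) (hi : Function.Injective h) :
    ∃ (H : Fin k ↪o Fin r) (σ : Equiv.Perm (Fin k)), ∀ s, h s = H (σ s) := by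
  refine ⟨OrderEmbedding.ofStrictMono (h ∘ Tuple.sort h)
    ((Tuple.monotone_sort h).strictMono_of_injective (hi.comp (Tuple.sort h).injective)),
    (Tuple.sort h)⁻¹, fun s => ?_⟩
  simp

theorem ord_det_submatrix_perm_left {k : ℕ} (W : Matrix (Fin r) (Fin r) (SparseField K))
    (f g : Fin k → Fin r) (σ : Equiv.Perm (Fin k)) :
    ord (W.submatrix (fun s => f (σ s)) g).det = ord (W.submatrix f g).det := by
  have := Matrix.det_permute σ (W.submatrix f g)
  rw [Matrix.submatrix_submatrix] at this
  change ord (W.submatrix (f ∘ σ) g).det = _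
  rw [Function.comp_id] at this
  rw [this, ord_sign_smul]

theorem ord_det_submatrix_perm_right {k : ℕ} (W : Matrix (Fin r) (Fin r) (SparseField K))
    (f g : Fin k → Fin r) (σ : Equiv.Perm (Fin k)) :
    ord (W.submatrix f (fun s => g (σ s))).det = ord (W.submatrix f g).det := by
  rw [← Matrix.det_transpose, Matrix.transpose_submatrix, ord_det_submatrix_perm_left,
    ← Matrix.transpose_submatrix, Matrix.det_transpose]

/-- A bound for all minors of fixed columns bounds all maximal determinants in these columns. -/
theorem le_ord_det_of_minor_rows {k : ℕ} (W : Matrix (Fin r) (Fin r) (SparseField K))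
    (g : Fin k → Fin r) (c : WithTop ℝ)
    (H : ∀ I : Fin k ↪o Fin r, c ≤ ord (W.submatrix I g).det) (f : Fin k → Fin r) :
    c ≤ ord (W.submatrix f g).det := by
  by_cases hi : Function.Injective f
  · obtain ⟨I, σ, e⟩ := exists_orderEmb_perm f hi
    rw [show f = fun s => I (σ s) from funext e, ord_det_submatrix_perm_left]
    exact H I
  · rw [Function.not_injective_iff] at hi
    obtain ⟨a, b, hab, hne⟩ := hi
    rw [Matrix.det_zero_of_row_eq hne (by funext t; simp [hab]), ord_zero]
    exact le_top

theorem le_ord_det_of_minor_cols {k : ℕ} (W : Matrix (Fin r) (Fin r) (SparseField K))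
    (f : Fin k → Fin r) (c : WithTop ℝ)
    (H : ∀ J : Fin k ↪o Fin r, c ≤ ord (W.submatrix f J).det) (g : Fin k → Fin r) :
    c ≤ ord (W.submatrix f g).det := by
  rw [← Matrix.det_transpose, Matrix.transpose_submatrix]
  refine le_ord_det_of_minor_rows _ f c (fun J => ?_) g
  rw [← Matrix.transpose_submatrix, Matrix.det_transpose]
  exact H J

theorem minor_D_mul_mul_D {k : ℕ} (μ w : Fin r → ℝ)
    (W : Matrix (Fin r) (Fin r) (SparseField K)) (f g : Fin k → Fin r) :
    ord ((D K μ * W * D K w).submatrix f g).det =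
      ((∑ s, μ (f s) + ∑ s, w (g s) : ℝ) : WithTop ℝ) + ord (W.submatrix f g).det := by
  have e : (D K μ * W * D K w).submatrix f g =
      Matrix.diagonal (fun s => tPow K (μ (f s))) * W.submatrix f g *
        Matrix.diagonal (fun s => tPow K (w (g s))) := by
    ext s t
    simp [D, Matrix.diagonal_mul, Matrix.mul_diagonal]
  rw [e, Matrix.det_mul, Matrix.det_mul, Matrix.det_diagonal, Matrix.det_diagonal, ord_mul,
    ord_mul, ord_prod, ord_prod]
  simp only [ord_tPow]
  rw [WithTop.coe_add, WithTop.coe_sum, WithTop.coe_sum, add_right_comm]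

/-! ### Existence of invariant partitions -/

theorem ord_inv {a : SparseField K} (ha : a ≠ 0) :
    ord a⁻¹ = ((-(a : HahnSeries ℝ K).order : ℝ) : WithTop ℝ) := by
  have h := ord_mul a a⁻¹
  rw [mul_inv_cancel₀ ha, ord_one, ← coe_order ha, ← coe_order (inv_ne_zero ha),
    ← WithTop.coe_add, eq_comm, WithTop.coe_eq_zero] at h
  rw [← coe_order (inv_ne_zero ha), WithTop.coe_inj]
  linarith

/-- Equivalence of matrices under multiplication by invertible matrices on both sides. -/
def MatEquiv (M N : Matrix (Fin r) (Fin r) (SparseField K)) : Prop :=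
  ∃ P Q : GL (Fin r) (ValRing K), toF P * M * toF Q = N

theorem MatEquiv.refl (M : Matrix (Fin r) (Fin r) (SparseField K)) : MatEquiv M M :=
  ⟨1, 1, by rw [toF_one, one_mul, mul_one]⟩

theorem MatEquiv.trans {M N T : Matrix (Fin r) (Fin r) (SparseField K)} (h : MatEquiv M N)
    (h' : MatEquiv N T) : MatEquiv M T := by
  obtain ⟨P, Q, rfl⟩ := h
  obtain ⟨P', Q', rfl⟩ := h'
  exact ⟨P' * P, Q * Q', by simp only [toF_mul, mul_assoc]⟩

theorem MatEquiv.symm {M N : Matrix (Fin r) (Fin r) (SparseField K)} (h : MatEquiv M N) :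
    MatEquiv N M := by
  obtain ⟨P, Q, rfl⟩ := h
  refine ⟨P⁻¹, Q⁻¹, ?_⟩
  calc toF P⁻¹ * (toF P * M * toF Q) * toF Q⁻¹
      = (toF P⁻¹ * toF P) * M * (toF Q * toF Q⁻¹) := by simp only [mul_assoc]
    _ = M := by rw [toF_inv_mul, toF_mul_inv, one_mul, mul_one]

/-- The transpose of an invertible matrix. -/
noncomputable def glTranspose (P : GL (Fin r) (ValRing K)) : GL (Fin r) (ValRing K) where
  val := P.val.transpose
  inv := P⁻¹.val.transpose
  val_inv := by rw [← Matrix.transpose_mul, ← Units.val_mul, inv_mul_cancel, Units.val_one,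
    Matrix.transpose_one]
  inv_val := by rw [← Matrix.transpose_mul, ← Units.val_mul, mul_inv_cancel, Units.val_one,
    Matrix.transpose_one]

theorem toF_glTranspose (P : GL (Fin r) (ValRing K)) :
    toF (glTranspose P) = (toF P).transpose := rfl

theorem MatEquiv.transpose {M N : Matrix (Fin r) (Fin r) (SparseField K)} (h : MatEquiv M N) :
    MatEquiv M.transpose N.transpose := by
  obtain ⟨P, Q, rfl⟩ := h
  exact ⟨glTranspose Q, glTranspose P, by
    simp only [toF_glTranspose, Matrix.transpose_mul, mul_assoc]⟩

/-- The matrix of a permutation, as an invertible matrix. -/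
noncomputable def glPerm (K : Type*) [Field K] (σ : Equiv.Perm (Fin r)) : GL (Fin r) (ValRing K) where
  val := (1 : Matrix (Fin r) (Fin r) (ValRing K)).submatrix σ id
  inv := (1 : Matrix (Fin r) (Fin r) (ValRing K)).submatrix id σ
  val_inv := by
    rw [Matrix.submatrix_mul _ _ _ _ _ Function.bijective_id |>.symm, one_mul]
    exact Matrix.submatrix_one_equiv σ
  inv_val := by
    rw [Matrix.submatrix_mul _ _ _ _ _ σ.bijective |>.symm, one_mul, Matrix.submatrix_id_id]

theorem toF_glPerm (σ : Equiv.Perm (Fin r)) :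
    toF (glPerm K σ) = (1 : Matrix (Fin r) (Fin r) (SparseField K)).submatrix σ id := by
  rw [toF, glPerm, ← Matrix.submatrix_map, Matrix.map_one _ rfl rfl]

theorem toF_glPerm_inv (σ : Equiv.Perm (Fin r)) :
    toF (glPerm K σ)⁻¹ = (1 : Matrix (Fin r) (Fin r) (SparseField K)).submatrix id σ := by
  change Matrix.map ((1 : Matrix (Fin r) (Fin r) (ValRing K)).submatrix id σ) _ = _
  rw [← Matrix.submatrix_map, Matrix.map_one _ rfl rfl]

theorem toF_glPerm_mul (σ : Equiv.Perm (Fin r)) (M : Matrix (Fin r) (Fin r) (SparseField K)) :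
    toF (glPerm K σ) * M = M.submatrix σ id := by
  rw [toF_glPerm]
  exact Matrix.one_submatrix_mul σ (Equiv.refl (Fin r)) M

theorem mul_toF_glPerm_inv (σ : Equiv.Perm (Fin r))
    (M : Matrix (Fin r) (Fin r) (SparseField K)) :
    M * toF (glPerm K σ)⁻¹ = M.submatrix id σ := by
  rw [toF_glPerm_inv]
  exact Matrix.mul_submatrix_one (Equiv.refl (Fin r)) σ M

theorem matEquiv_submatrix (σ τ : Equiv.Perm (Fin r))
    (M : Matrix (Fin r) (Fin r) (SparseField K)) : MatEquiv M (M.submatrix σ τ) :=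
  ⟨glPerm K σ, (glPerm K τ)⁻¹, by
    rw [toF_glPerm_mul, mul_toF_glPerm_inv, Matrix.submatrix_submatrix]; rfl⟩

/-- The block matrix with blocks `1` and `P`, with the column `c` below the upper left entry. -/
def colBlock {R : Type*} [CommRing R] {n : ℕ} (c : Fin n → R) (P : Matrix (Fin n) (Fin n) R) :
    Matrix (Fin (n + 1)) (Fin (n + 1)) R :=
  Matrix.of (Fin.cons (Fin.cons 1 0) fun i => Fin.cons (c i) (P i))

section colBlock

variable {R : Type*} [CommRing R] {n : ℕ} (c d : Fin n → R) (P Q : Matrix (Fin n) (Fin n) R)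

theorem colBlock_mul : colBlock c P * colBlock d Q =
    colBlock (fun i => c i + ∑ j, P i j * d j) (P * Q) := by
  ext i j
  refine Fin.cases ?_ (fun i => ?_) i <;> refine Fin.cases ?_ (fun j => ?_) j <;>
    simp [colBlock, Matrix.mul_apply, Fin.sum_univ_succ]

theorem colBlock_zero_one : colBlock (0 : Fin n → R) 1 = 1 := by
  ext i j
  refine Fin.cases ?_ (fun i => ?_) i <;> refine Fin.cases ?_ (fun j => ?_) j <;>
    simp [colBlock, Matrix.one_apply, Fin.succ_ne_zero, (Fin.succ_ne_zero _).symm]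

end colBlock

/-- The invertible matrix adding multiples of the first row to the others. -/
noncomputable def glCol {n : ℕ} (c : Fin n → ValRing K) : GL (Fin (n + 1)) (ValRing K) where
  val := colBlock c 1
  inv := colBlock (-c) 1
  val_inv := by
    rw [colBlock_mul, mul_one, ← colBlock_zero_one]
    congr 1
    funext i
    simp [Matrix.one_apply]
  inv_val := by
    rw [colBlock_mul, mul_one, ← colBlock_zero_one]
    congr 1
    funext i
    simp [Matrix.one_apply]

/-- The invertible matrix with blocks `1` and `P`. -/
noncomputable def glBlock {n : ℕ} (P : GL (Fin n) (ValRing K)) : GL (Fin (n + 1)) (ValRing K) where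
  val := colBlock 0 P.val
  inv := colBlock 0 P⁻¹.val
  val_inv := by
    rw [colBlock_mul, ← Units.val_mul, mul_inv_cancel, ← colBlock_zero_one]
    simp; rfl
  inv_val := by
    rw [colBlock_mul, ← Units.val_mul, inv_mul_cancel, ← colBlock_zero_one]
    simp; rfl

theorem toF_glCol {n : ℕ} (c : Fin n → ValRing K) :
    toF (glCol c) = colBlock (fun i => (c i : SparseField K)) 1 := by
  ext i j
  refine Fin.cases ?_ (fun i => ?_) i <;> refine Fin.cases ?_ (fun j => ?_) j <;>
    simp [glCol, toF, colBlock, Matrix.one_apply, apply_ite]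

theorem toF_glBlock {n : ℕ} (P : GL (Fin n) (ValRing K)) :
    toF (glBlock P) = colBlock 0 (toF P) := by
  ext i j
  refine Fin.cases ?_ (fun i => ?_) i <;> refine Fin.cases ?_ (fun j => ?_) j <;>
    simp [glBlock, toF, colBlock]

/-- If the upper left entry has minimal order in its column, the column can be cleared without
changing the first row. -/
theorem exists_clear_column {n : ℕ} (M : Matrix (Fin (n + 1)) (Fin (n + 1)) (SparseField K))
    (h0 : M 0 0 ≠ 0) (hmin : ∀ i, ord (M 0 0) ≤ ord (M i 0)) :
    ∃ c : Fin n → ValRing K, (∀ j, (toF (glCol c) * M) 0 j = M 0 j) ∧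
      (∀ i : Fin n, (toF (glCol c) * M) i.succ 0 = 0) := by
  have hc : ∀ i : Fin n, -(M i.succ 0 * (M 0 0)⁻¹) ∈ ValRing K := by
    intro i
    change 0 ≤ ord _
    rw [ord_neg]
    rw [ord_mul, ord_inv h0]
    by_cases hi : M i.succ 0 = 0
    · rw [hi, ord_zero, WithTop.top_add]
      exact le_top
    · have h1 := hmin i.succ
      rw [← coe_order h0, ← coe_order hi, WithTop.coe_le_coe] at h1
      rw [← coe_order hi, ← WithTop.coe_add]
      exact WithTop.coe_nonneg.2 (by linarith)
  refine ⟨fun i => ⟨_, hc i⟩, fun j => ?_, fun i => ?_⟩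
  · simp [toF_glCol, Matrix.mul_apply, Fin.sum_univ_succ, colBlock]
  · simp [toF_glCol, Matrix.mul_apply, Fin.sum_univ_succ, colBlock, Matrix.one_apply, h0]

theorem exists_ord_minimal {n : ℕ} (M : Matrix (Fin (n + 1)) (Fin (n + 1)) (SparseField K)) :
    ∃ a b, ∀ i j, ord (M a b) ≤ ord (M i j) := by
  obtain ⟨p, -, hp⟩ := Finset.exists_min_image (Finset.univ : Finset (Fin (n + 1) × Fin (n + 1)))
    (fun p => ord (M p.1 p.2)) ⟨(0, 0), Finset.mem_univ _⟩
  exact ⟨p.1, p.2, fun i j => hp (i, j) (Finset.mem_univ _)⟩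

theorem MatEquiv.det_ne_zero {M N : Matrix (Fin r) (Fin r) (SparseField K)} (h : MatEquiv M N)
    (hM : M.det ≠ 0) : N.det ≠ 0 := by
  obtain ⟨P, Q, rfl⟩ := h
  rw [Matrix.det_mul, Matrix.det_mul]
  exact mul_ne_zero (mul_ne_zero (det_toF_ne_zero P) hM) (det_toF_ne_zero Q)

/-- Smith normal form over a valuation ring: an entry of minimal order divides all others, so once
moved to the corner it clears its column and its row, and induction handles the remaining block. -/
theorem exists_matEquiv_diagonal : ∀ (r : ℕ) (M : Matrix (Fin r) (Fin r) (SparseField K)),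
    M.det ≠ 0 → ∃ d : Fin r → SparseField K, MatEquiv M (Matrix.diagonal d) := by
  intro r
  induction r with
  | zero =>
    intro M _
    refine ⟨0, ?_⟩
    rw [Subsingleton.elim (Matrix.diagonal 0) M]
    exact MatEquiv.refl M
  | succ n ih =>
    intro M hM
    obtain ⟨a, b, hab⟩ := exists_ord_minimal M
    have hab0 : M a b ≠ 0 := by
      intro h
      apply hM
      rw [h, ord_zero] at hab
      have : M = 0 := by
        refine Matrix.ext fun i j => ?_
        exact ord_eq_top.1 (top_le_iff.1 (hab i j))
      rw [this, Matrix.det_zero]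
    set N := M.submatrix (Equiv.swap 0 a) (Equiv.swap 0 b) with hN
    have hMN : MatEquiv M N := matEquiv_submatrix _ _ _
    have hN00 : N 0 0 = M a b := by simp [hN]
    have hmin : ∀ i j, ord (N 0 0) ≤ ord (N i j) := fun i j => hN00 ▸ hab _ _
    obtain ⟨c, hc1, hc2⟩ := exists_clear_column N (hN00 ▸ hab0) fun i => hmin i 0
    set T := toF (glCol c) * N with hT
    have hNT : MatEquiv N T := ⟨glCol c, 1, by rw [toF_one, mul_one]⟩
    -- Clearing the column left the first row unchanged, so the pivot is still minimal in its row;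
    -- the row is cleared as a column of the transpose.
    obtain ⟨e, he1, he2⟩ := exists_clear_column T.transpose
      (by rw [Matrix.transpose_apply, hc1]; exact hN00 ▸ hab0)
      (fun i => by rw [Matrix.transpose_apply, Matrix.transpose_apply, hc1, hc1]; exact hmin 0 i)
    set U := (toF (glCol e) * T.transpose).transpose with hU
    have hTU : MatEquiv T U := by
      have : MatEquiv T.transpose (toF (glCol e) * T.transpose) :=
        ⟨glCol e, 1, by rw [toF_one, mul_one]⟩
      exact this.transpose
    have hU1 : ∀ i, U i 0 = T i 0 := fun i => he1 i
    have hU2 : ∀ i : Fin n, U 0 i.succ = 0 := fun i => he2 i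
    have hU3 : ∀ i : Fin n, U i.succ 0 = 0 := fun i => (hU1 _).trans (hc2 i)
    have hMU := (hMN.trans hNT).trans hTU
    have hdet : (U.submatrix Fin.succ Fin.succ).det ≠ 0 := by
      intro h
      apply hMU.det_ne_zero hM
      rw [Matrix.det_succ_row_zero, Fin.sum_univ_succ]
      simp only [hU2]
      have : (Fin.succAbove (0 : Fin (n + 1))) = Fin.succ := by funext i; simp
      simp [this, h]
    obtain ⟨d, P, Q, hPQ⟩ := ih _ hdet
    refine ⟨Fin.cons (U 0 0) d, hMU.trans ⟨glBlock P, glBlock Q, ?_⟩⟩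
    rw [toF_glBlock, toF_glBlock]
    ext i j : 2
    have hentry : ∀ i j, (toF P * U.submatrix Fin.succ Fin.succ * toF Q) i j =
        Matrix.diagonal d i j := fun i j => by rw [hPQ]
    refine Fin.cases ?_ (fun i => ?_) i <;> refine Fin.cases ?_ (fun j => ?_) j
    · simp [colBlock, Matrix.mul_apply, Fin.sum_univ_succ]
    · simp [colBlock, Matrix.mul_apply, Fin.sum_univ_succ, hU2, (Fin.succ_ne_zero _).symm]
    · simp [colBlock, Matrix.mul_apply, Fin.sum_univ_succ, hU3, Fin.succ_ne_zero]
    · have := hentry i j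
      simp only [Matrix.mul_apply, Matrix.submatrix_apply] at this
      simp [colBlock, Matrix.mul_apply, Fin.sum_univ_succ, this, Matrix.diagonal_apply]

theorem exists_matEquiv_D (M : Matrix (Fin r) (Fin r) (SparseField K)) (hM : M.det ≠ 0) :
    ∃ lam : Fin r → ℝ, MatEquiv M (D K lam) := by
  obtain ⟨d, hd⟩ := exists_matEquiv_diagonal r M hM
  have hdet := hd.det_ne_zero hM
  rw [Matrix.det_diagonal, Finset.prod_ne_zero_iff] at hdet
  have hd0 : ∀ i, d i ≠ 0 := fun i => hdet i (Finset.mem_univ i)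
  let lam : Fin r → ℝ := fun i => (d i : HahnSeries ℝ K).order
  have hlam : ∀ i, ord (d i) = lam i := fun i => (coe_order (hd0 i)).symm
  have h1 : ∀ i, ord ((d i)⁻¹) = ((-lam i : ℝ) : WithTop ℝ) := fun i => ord_inv (hd0 i)
  -- Both factors have order 0, so `p i` and `q i` are mutually inverse units that replace `d i` by
  -- a pure power of t.
  let p : Fin r → ValRing K := fun i => ⟨(d i)⁻¹ * tPow K (lam i), by
    change 0 ≤ ord _
    rw [ord_mul, h1, ord_tPow, ← WithTop.coe_add, neg_add_cancel]
    exact le_rfl⟩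
  let q : Fin r → ValRing K := fun i => ⟨d i * tPow K (-lam i), by
    change 0 ≤ ord _
    rw [ord_mul, hlam, ord_tPow, ← WithTop.coe_add, add_neg_cancel]
    exact le_rfl⟩
  have hpq : ∀ i, p i * q i = 1 := by
    intro i
    apply Subtype.ext
    change (d i)⁻¹ * tPow K (lam i) * (d i * tPow K (-lam i)) = 1
    rw [← inv_tPow]
    have := tPow_ne_zero (K := K) (lam i)
    have := hd0 i
    field_simp
  let P : GL (Fin r) (ValRing K) :=
    { val := Matrix.diagonal p
      inv := Matrix.diagonal q
      val_inv := by
        rw [Matrix.diagonal_mul_diagonal, ← Matrix.diagonal_one]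
        exact congrArg _ (funext hpq)
      inv_val := by
        rw [Matrix.diagonal_mul_diagonal, ← Matrix.diagonal_one]
        exact congrArg _ (funext fun i => (mul_comm _ _).trans (hpq i)) }
  refine ⟨lam, hd.trans ⟨P, 1, ?_⟩⟩
  have hP : toF P = Matrix.diagonal fun i => (d i)⁻¹ * tPow K (lam i) := by
    change (Matrix.diagonal p).map _ = _
    rw [Matrix.diagonal_map rfl]
  rw [toF_one, mul_one, hP, Matrix.diagonal_mul_diagonal, D]
  congr 1
  funext i
  rw [mul_right_comm, inv_mul_cancel₀ (hd0 i), one_mul]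

theorem hasInv_iff {M : Matrix (Fin r) (Fin r) (SparseField K)} {lam : Fin r → ℝ} :
    HasInv M lam ↔ Antitone lam ∧ MatEquiv M (D K lam) := by
  refine and_congr_right fun _ => ⟨fun ⟨P, Q, h⟩ => ⟨P, Q⁻¹, h⟩, fun ⟨P, Q, h⟩ => ⟨P, Q⁻¹, ?_⟩⟩
  rw [inv_inv]
  exact h

/-- This makes the choice in the definition of `inv` meaningful: diagonalize, then sort the
exponents by a permutation of rows and columns. -/
theorem hasInv_inv {M : Matrix (Fin r) (Fin r) (SparseField K)} (hM : M.det ≠ 0) :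
    HasInv M (inv M) := by
  apply Classical.epsilon_spec (p := HasInv M)
  obtain ⟨lam, h⟩ := exists_matEquiv_D M hM
  let σ : Equiv.Perm (Fin r) := Tuple.sort (fun i => -lam i)
  refine ⟨lam ∘ σ, hasInv_iff.2 ⟨fun i j hij => ?_, h.trans ?_⟩⟩
  · have := Tuple.monotone_sort (fun i => -lam i) hij
    simp only [Function.comp_apply, neg_le_neg_iff] at this
    exact this
  · have := matEquiv_submatrix σ σ (D K lam)
    rwa [D, Matrix.submatrix_diagonal_equiv] at this

theorem inv_congr {M N : Matrix (Fin r) (Fin r) (SparseField K)} (h : MatEquiv M N) :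
    inv M = inv N := by
  unfold inv
  congr 1
  funext lam
  rw [hasInv_iff, hasInv_iff]
  exact propext (and_congr_right fun _ => ⟨fun h' => h.symm.trans h', fun h' => h.trans h'⟩)

theorem inv_transpose (M : Matrix (Fin r) (Fin r) (SparseField K)) :
    inv M.transpose = inv M := by
  unfold inv
  congr 1
  funext lam
  rw [hasInv_iff, hasInv_iff]
  have hD : (D K lam).transpose = D K lam := Matrix.diagonal_transpose _
  refine propext (and_congr_right fun _ => ⟨fun h' => ?_, fun h' => ?_⟩)
  · have := h'.transpose
    rwa [hD, Matrix.transpose_transpose] at this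
  · have := h'.transpose
    rwa [hD] at this

/-! ### Intervals of indices -/

/-- The index set of the `k` consecutive indices starting with `a`. -/
def seg (a k : ℕ) (h : a + k ≤ r) : Fin k ↪o Fin r :=
  OrderEmbedding.ofStrictMono (fun s => ⟨a + s, by omega⟩) fun s t hst => by
    simp only [Fin.lt_def] at hst ⊢
    omega

@[simp]
theorem val_seg {a k : ℕ} (h : a + k ≤ r) (s : Fin k) : (seg a k h s).val = a + s := rfl

theorem add_sub_le_of_lt {k : ℕ} (I : Fin k ↪o Fin r) {s t : Fin k} (hst : s ≤ t) :
    (I s).val + (t.val - s.val) ≤ (I t).val := by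
  obtain ⟨n, hn⟩ : ∃ n, t.val = s.val + n := ⟨t.val - s.val, by
    have := Fin.le_def.1 hst; omega⟩
  induction n generalizing t with
  | zero =>
    have : t = s := Fin.ext hn
    subst this
    omega
  | succ n ih =>
    have h1 := ih (t := ⟨s.val + n, by omega⟩) (Fin.le_def.2 (by simp)) rfl
    have h2 : I ⟨s.val + n, by omega⟩ < I t := I.strictMono (Fin.lt_def.2 (by simp; omega))
    rw [Fin.lt_def] at h2
    simp only at h1
    omega

theorem idxLE_seg_last {a k : ℕ} (h : a + k = r) (I : Fin k ↪o Fin r) :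
    IdxLE I (seg a k h.le) := by
  intro s
  have hs := s.isLt
  have h1 := add_sub_le_of_lt I (s := s) (t := ⟨k - 1, by omega⟩) (Fin.le_def.2 (by simp; omega))
  have h2 := (I ⟨k - 1, by omega⟩).isLt
  rw [Fin.le_def, val_seg]
  simp only at h1
  omega

theorem idxLE_seg_zero {k : ℕ} (h : 0 + k ≤ r) (I : Fin k ↪o Fin r) : IdxLE (seg 0 k h) I := by
  intro s
  have hs := s.isLt
  have h1 := add_sub_le_of_lt I (s := ⟨0, by omega⟩) (t := s) (Fin.le_def.2 (by simp))
  rw [Fin.le_def, val_seg]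
  simp only at h1
  omega

theorem IdxLE.wt_le {k : ℕ} {μ : Fin r → ℝ} (hμ : Antitone μ) {I H : Fin k ↪o Fin r}
    (h : IdxLE I H) : wt μ H ≤ wt μ I :=
  Finset.sum_le_sum fun s _ => hμ (h s)

/-- Minors give access only to tail sums of a partition; differences of consecutive tail sums
recover its entries. -/
theorem wt_seg_succ (μ : Fin r → ℝ) (a k : ℕ) (h : a + (k + 1) ≤ r) :
    wt μ (seg a (k + 1) h) = μ ⟨a, by omega⟩ + wt μ (seg (a + 1) k (by omega)) := by
  unfold wt
  rw [Fin.sum_univ_succ]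
  congr 1
  refine Finset.sum_congr rfl fun s _ => ?_
  congr 1
  apply Fin.ext
  simp only [val_seg, Fin.val_succ]
  omega

theorem lastCols_eq_seg {a k : ℕ} (hk : k ≤ r) (h : a + k = r) : lastCols hk = seg a k h.le := by
  apply DFunLike.ext
  intro s
  apply Fin.ext
  change (r - k) + s.val = a + s.val
  omega

/-! ### Invariant partitions and minors -/

theorem ord_det_nonneg {k : ℕ} (W : Matrix (Fin k) (Fin k) (SparseField K))
    (h : ∀ i j, 0 ≤ ord (W i j)) : 0 ≤ ord W.det := by
  rw [Matrix.det_apply']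
  refine le_ord_sum _ _ _ fun σ _ => ?_
  rw [ord_sign_smul, ord_prod]
  exact Finset.sum_nonneg fun s _ => h _ _

theorem MatEquiv.le_ord_det {k : ℕ} {M N : Matrix (Fin r) (Fin r) (SparseField K)}
    (h : MatEquiv M N) (c : WithTop ℝ)
    (hM : ∀ f g : Fin k → Fin r, c ≤ ord (M.submatrix f g).det) (f g : Fin k → Fin r) :
    c ≤ ord (N.submatrix f g).det := by
  obtain ⟨P, Q, rfl⟩ := h
  exact le_ord_det_mul_integral _ _ (ord_toF_nonneg Q) f c
    (fun g => le_ord_det_integral_mul _ _ (ord_toF_nonneg P) g c (fun f => hM f g) f) g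

/-- Determinantal divisors: a common lower bound for all k×k minors is unaffected by equivalence, so
it can be tested on D_lam. There a minor is a power of t times a minor of the identity, and the
smallest exponent belongs to the last k indices because `lam` decreases. -/
theorem le_ord_minor_iff {M : Matrix (Fin r) (Fin r) (SparseField K)} {lam : Fin r → ℝ}
    (h : HasInv M lam) {a k : ℕ} (hk : a + k = r) (c : WithTop ℝ) :
    (∀ I J : Fin k ↪o Fin r, c ≤ ord (minor M I J)) ↔
      c ≤ ((wt lam (seg a k hk.le) : ℝ) : WithTop ℝ) := by
  rw [hasInv_iff] at h
  obtain ⟨hlam, hM⟩ := h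
  have hD : ∀ f g : Fin k → Fin r, ord ((D K lam).submatrix f g).det =
      ((∑ s, lam (f s) : ℝ) : WithTop ℝ) +
        ord ((1 : Matrix (Fin r) (Fin r) (SparseField K)).submatrix f g).det := by
    intro f g
    have := minor_D_mul_mul_D lam 0 (1 : Matrix (Fin r) (Fin r) (SparseField K)) f g
    have h0 : D K (0 : Fin r → ℝ) = 1 := by
      rw [D, ← Matrix.diagonal_one]
      rfl
    rw [h0, mul_one, mul_one] at this
    rw [this]
    simp
  constructor
  · intro H
    have h1 := hM.le_ord_det c (fun f g => le_ord_det_of_minor_rows M g c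
      (fun I => le_ord_det_of_minor_cols M I c (fun J => H I J) g) f) (seg a k hk.le)
      (seg a k hk.le)
    rw [hD] at h1
    rw [Matrix.submatrix_one _ (seg a k hk.le).injective, Matrix.det_one, ord_one, add_zero] at h1
    exact h1
  · intro H I J
    refine hM.symm.le_ord_det c (fun f g => le_ord_det_of_minor_rows _ g c (fun I => ?_) f) I J
    rw [hD]
    refine le_add_of_le_of_nonneg (H.trans (WithTop.coe_le_coe.2 ?_)) (ord_det_nonneg _ ?_)
    · exact (idxLE_seg_last hk I).wt_le hlam
    · intro i j
      rw [Matrix.submatrix_apply, Matrix.one_apply]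
      split_ifs
      · exact ord_one.ge
      · rw [ord_zero]
        exact le_top

theorem wt_seg_eq_of_minors {M : Matrix (Fin r) (Fin r) (SparseField K)} {lam : Fin r → ℝ}
    (h : HasInv M lam) {a k : ℕ} (hk : a + k = r) (c : ℝ)
    (hle : ∀ I J : Fin k ↪o Fin r, (c : WithTop ℝ) ≤ ord (minor M I J))
    (hex : ∃ I J : Fin k ↪o Fin r, ord (minor M I J) ≤ c) : wt lam (seg a k hk.le) = c := by
  apply le_antisymm
  · obtain ⟨I, J, hIJ⟩ := hex
    exact WithTop.coe_le_coe.1 (((le_ord_minor_iff h hk _).2 le_rfl I J).trans hIJ)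
  · exact WithTop.coe_le_coe.1 ((le_ord_minor_iff h hk _).1 hle)

theorem HasInv.unique {M : Matrix (Fin r) (Fin r) (SparseField K)} {lam lam' : Fin r → ℝ}
    (h : HasInv M lam) (h' : HasInv M lam') : lam = lam' := by
  have key : ∀ (a k : ℕ) (hk : a + k = r),
      wt lam (seg a k hk.le) = wt lam' (seg a k hk.le) := fun a k hk =>
    le_antisymm
      (WithTop.coe_le_coe.1 ((le_ord_minor_iff h' hk _).1 ((le_ord_minor_iff h hk _).2 le_rfl)))
      (WithTop.coe_le_coe.1 ((le_ord_minor_iff h hk _).1 ((le_ord_minor_iff h' hk _).2 le_rfl)))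
  funext j
  obtain ⟨k, hk⟩ : ∃ k, j.val + (k + 1) = r := ⟨r - j.val - 1, by omega⟩
  have h1 := key _ _ hk
  have h2 := key (j.val + 1) k (by omega)
  rw [wt_seg_succ, wt_seg_succ] at h1
  have h3 : lam j + wt lam (seg (j.val + 1) k (by omega)) =
    lam' j + wt lam' (seg (j.val + 1) k (by omega)) := h1
  linarith

/-! ### Interlacing -/

theorem le_ord_mulVec {X : Matrix (Fin r) (Fin r) (SparseField K)} (hX : ∀ i j, 0 ≤ ord (X i j))
    {v : Fin r → SparseField K} {c : WithTop ℝ} (hv : ∀ i, c ≤ ord (v i)) (i : Fin r) :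
    c ≤ ord (X.mulVec v i) := by
  rw [Matrix.mulVec, dotProduct]
  refine le_ord_sum _ _ _ fun j _ => ?_
  rw [ord_mul]
  exact le_add_of_nonneg_of_le (hX i j) (hv j)

theorem exists_min_ord {v : Fin r → SparseField K} (hv : v ≠ 0) :
    ∃ (i : Fin r) (m : ℝ), ord (v i) = m ∧ ∀ j, (m : WithTop ℝ) ≤ ord (v j) := by
  obtain ⟨q, hq⟩ := Function.ne_iff.1 hv
  obtain ⟨i, -, hi⟩ := Finset.exists_min_image Finset.univ (fun i => ord (v i))
    ⟨q, Finset.mem_univ _⟩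
  have h0 : v i ≠ 0 := by
    intro h
    have := hi q (Finset.mem_univ _)
    rw [h, ord_zero, top_le_iff, ord_eq_top] at this
    exact hq this
  refine ⟨i, _, (coe_order h0).symm, fun j => ?_⟩
  rw [coe_order h0]
  exact hi j (Finset.mem_univ _)

/-- The number of linear conditions is j + (r − 1 − j') + 1, which is less than r because j < j'. -/
theorem exists_common_kernel (A B : Matrix (Fin r) (Fin r) (SparseField K)) (p j j' : Fin r)
    (hj : j < j') : ∃ v : Fin r → SparseField K, v ≠ 0 ∧ v p = 0 ∧
      (∀ i, i < j → A.mulVec v i = 0) ∧ (∀ i, j' < i → B.mulVec v i = 0) := by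
  let φ : (Fin r → SparseField K) →ₗ[SparseField K]
      ((Finset.Iio j ⊕ Finset.Ioi j') ⊕ Unit → SparseField K) :=
    LinearMap.pi (Sum.elim (Sum.elim (fun i => LinearMap.proj i.1 ∘ₗ A.mulVecLin)
      fun i => LinearMap.proj i.1 ∘ₗ B.mulVecLin) fun _ => LinearMap.proj p)
  have hlt : Module.finrank (SparseField K) ((Finset.Iio j ⊕ Finset.Ioi j') ⊕ Unit →
      SparseField K) < Module.finrank (SparseField K) (Fin r → SparseField K) := by
    rw [Module.finrank_fintype_fun_eq_card, Module.finrank_fintype_fun_eq_card]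
    rw [Fintype.card_sum, Fintype.card_sum, Fintype.card_coe, Fintype.card_coe, Fin.card_Iio,
      Fin.card_Ioi, Fintype.card_fin, Fintype.card_unit]
    have := Fin.lt_def.1 hj
    omega
  obtain ⟨v, hv, hv0⟩ := (Submodule.ne_bot_iff _).1 (LinearMap.ker_ne_bot_of_finrank_lt (f := φ) hlt)
  rw [LinearMap.mem_ker] at hv
  refine ⟨v, hv0, congrFun hv (Sum.inr ()), fun i hi => ?_, fun i hi => ?_⟩
  · exact congrFun hv (Sum.inl (Sum.inl ⟨i, Finset.mem_Iio.2 hi⟩))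
  · exact congrFun hv (Sum.inl (Sum.inr ⟨i, Finset.mem_Ioi.2 hi⟩))

theorem ord_D_mulVec (lam : Fin r → ℝ) (w : Fin r → SparseField K) (i : Fin r) :
    ord ((D K lam).mulVec w i) = (lam i : WithTop ℝ) + ord (w i) := by
  rw [D, Matrix.mulVec_diagonal, ord_mul, ord_tPow]

/-- Multiplication of one column by a scalar moves the invariants at most one place. -/
theorem HasInv.interlace {M : Matrix (Fin r) (Fin r) (SparseField K)} {lam lam' : Fin r → ℝ}
    (h : HasInv M lam) (d : Fin r → SparseField K) (p : Fin r) (hd : ∀ q, q ≠ p → d q = 1)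
    (h' : HasInv (M * Matrix.diagonal d) lam') {j j' : Fin r} (hj : j < j') :
    lam' j' ≤ lam j := by
  obtain ⟨hlam, P, Q, hPQ⟩ := h
  obtain ⟨hlam', P', Q', hPQ'⟩ := h'
  obtain ⟨v, hv0, hvp, hA, hB⟩ := exists_common_kernel (toF Q) (toF Q') p j j' hj
  obtain ⟨i₀, m, hm, hmin⟩ := exists_min_ord hv0
  -- As v vanishes at `p`, the rescaling does not affect it, and both normal forms can be used to
  -- estimate the same vector M v.
  have hdv : (Matrix.diagonal d).mulVec v = v := by
    funext q
    rw [Matrix.mulVec_diagonal]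
    by_cases hq : q = p
    · rw [hq, hvp, mul_zero]
    · rw [hd q hq, one_mul]
  have e1 : (D K lam).mulVec ((toF Q).mulVec v) = (toF P).mulVec (M.mulVec v) := by
    rw [← hPQ, Matrix.mulVec_mulVec, mul_assoc, toF_inv_mul, mul_one, Matrix.mulVec_mulVec]
  have e2 : M.mulVec v = (toF P'⁻¹).mulVec ((D K lam').mulVec ((toF Q').mulVec v)) := by
    rw [← hPQ', Matrix.mulVec_mulVec, Matrix.mulVec_mulVec, ← mul_assoc, ← mul_assoc,
      ← mul_assoc, toF_inv_mul, one_mul, mul_assoc, toF_inv_mul, mul_one, ← Matrix.mulVec_mulVec,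
      hdv]
  -- Only coordinates up to j' of Q'v survive, and there the exponents of D_lam' are at least lam'
  -- j'.
  have h1 : ∀ i, ((lam' j' + m : ℝ) : WithTop ℝ) ≤ ord (M.mulVec v i) := by
    rw [e2]
    refine le_ord_mulVec (ord_toF_nonneg _) fun i => ?_
    rw [ord_D_mulVec]
    rcases lt_or_ge j' i with hi | hi
    · rw [hB i hi, ord_zero, WithTop.add_top]
      exact le_top
    · rw [WithTop.coe_add]
      exact add_le_add (WithTop.coe_le_coe.2 (hlam' hi)) (le_ord_mulVec (ord_toF_nonneg _) hmin i)
  have hw0 : (toF Q).mulVec v ≠ 0 := by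
    intro h0
    apply hv0
    rw [← Matrix.one_mulVec v, ← toF_inv_mul Q, ← Matrix.mulVec_mulVec, h0, Matrix.mulVec_zero]
  obtain ⟨i₁, m', hm', hmin'⟩ := exists_min_ord hw0
  -- Applying Q⁻¹ to Qv shows that Q does not raise the least order. The coordinate of Qv attaining
  -- it lies at or after j, where the exponents of D_lam are at most lam j.
  have hmm : m' ≤ m := by
    have := le_ord_mulVec (ord_toF_nonneg Q⁻¹) hmin' i₀
    rw [Matrix.mulVec_mulVec, toF_inv_mul, Matrix.one_mulVec, hm] at this
    exact WithTop.coe_le_coe.1 this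
  have hi₁ : j ≤ i₁ := by
    by_contra hlt
    rw [hA i₁ (not_le.1 hlt), ord_zero] at hm'
    exact WithTop.top_ne_coe hm'
  have h2 := le_ord_mulVec (ord_toF_nonneg P) h1 i₁
  rw [← e1, ord_D_mulVec, hm', ← WithTop.coe_add, WithTop.coe_le_coe] at h2
  have := hlam hi₁
  linarith

/-! ### Rearrangement -/

/-- Exchange argument: if the last index is not fixed, a transposition makes it fixed, and the Monge
inequality says that this does not increase the sum. Induction applies to the other indices. -/
theorem sum_diag_le_sum_perm_of_monge : ∀ (k : ℕ) (c : Fin k → Fin k → ℝ),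
    (∀ s s' q q', s < s' → q < q' → c s q + c s' q' ≤ c s q' + c s' q) →
    ∀ σ : Equiv.Perm (Fin k), ∑ s, c s s ≤ ∑ s, c s (σ s) := by
  intro k
  induction k with
  | zero => intro c _ σ; simp
  | succ k ih =>
    intro c hc
    have fixed : ∀ σ : Equiv.Perm (Fin (k + 1)), σ (Fin.last k) = Fin.last k →
        ∑ s, c s s ≤ ∑ s, c s (σ s) := by
      intro σ hσ
      have hne : ∀ s : Fin k, σ s.castSucc ≠ Fin.last k := fun s h =>
        (Fin.castSucc_lt_last s).ne (σ.injective (h.trans hσ.symm))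
      let f : Fin k → Fin k := fun s => (σ s.castSucc).castPred (hne s)
      have hf : ∀ s, (f s).castSucc = σ s.castSucc := fun s => Fin.castSucc_castPred _ _
      have hinj : Function.Injective f := fun s t hst => by
        have := congrArg Fin.castSucc hst
        rw [hf, hf] at this
        exact Fin.castSucc_injective k (σ.injective this)
      have h1 := ih (fun s q => c s.castSucc q.castSucc)
        (fun s s' q q' h h' => hc _ _ _ _ (by simpa using h) (by simpa using h'))
        (Equiv.ofBijective f (Finite.injective_iff_bijective.1 hinj))
      rw [Fin.sum_univ_castSucc, Fin.sum_univ_castSucc, hσ]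
      refine add_le_add_left (h1.trans_eq (Finset.sum_congr rfl fun s _ => ?_)) _
      rw [Equiv.ofBijective_apply, hf]
    intro σ
    by_cases hσ : σ (Fin.last k) = Fin.last k
    · exact fixed σ hσ
    · let q := σ (Fin.last k)
      let p := σ.symm (Fin.last k)
      have hp : σ p = Fin.last k := σ.apply_symm_apply _
      have hpl : p ≠ Fin.last k := fun h => hσ (h ▸ hp)
      let τ : Equiv.Perm (Fin (k + 1)) := σ.trans (Equiv.swap q (Fin.last k))
      have hτl : τ (Fin.last k) = Fin.last k := Equiv.swap_apply_left _ _
      have hτp : τ p = q := by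
        change Equiv.swap q (Fin.last k) (σ p) = q
        rw [hp, Equiv.swap_apply_right]
      have hτ : ∀ s, s ≠ p → s ≠ Fin.last k → τ s = σ s := fun s h1 h2 =>
        Equiv.swap_apply_of_ne_of_ne (fun h => h2 (σ.injective h))
          (fun h => h1 (σ.injective (h.trans hp.symm)))
      refine (fixed τ hτl).trans ?_
      have hsplit : ∀ g : Fin (k + 1) → ℝ, ∑ s, g s =
          g p + (g (Fin.last k) + ∑ s ∈ (Finset.univ.erase p).erase (Fin.last k), g s) := by
        intro g
        rw [Finset.add_sum_erase _ _ (Finset.mem_erase.2 ⟨hpl.symm, Finset.mem_univ _⟩),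
          Finset.add_sum_erase _ _ (Finset.mem_univ _)]
      rw [hsplit, hsplit (fun s => c s (σ s)), hτl, hτp, hp]
      have h2 : ∑ s ∈ (Finset.univ.erase p).erase (Fin.last k), c s (τ s) =
          ∑ s ∈ (Finset.univ.erase p).erase (Fin.last k), c s (σ s) := by
        refine Finset.sum_congr rfl fun s hs => ?_
        simp only [Finset.mem_erase] at hs
        rw [hτ s hs.2.1 hs.1]
      have h3 := hc p (Fin.last k) q (Fin.last k) (Fin.lt_last_iff_ne_last.2 hpl)
        (Fin.lt_last_iff_ne_last.2 hσ)
      rw [h2]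
      linarith

/-- The maximum of two decreasing sequences is a Monge array. For sequences μ∘I and μ∘H the sorted
pairing gives the weight of the componentwise minimum of I and H. -/
theorem sum_max_le_sum_max_perm {k : ℕ} (a b : Fin k → ℝ) (ha : Antitone a) (hb : Antitone b)
    (σ : Equiv.Perm (Fin k)) : ∑ s, max (a s) (b s) ≤ ∑ s, max (a s) (b (σ s)) := by
  refine sum_diag_le_sum_perm_of_monge k (fun s q => max (a s) (b q)) ?_ σ
  intro s s' q q' h h'
  have h1 := ha h.le
  have h2 := hb h'.le
  rcases max_cases (a s) (b q') with ⟨e1, _⟩ | ⟨e1, _⟩ <;>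
  rcases max_cases (a s') (b q) with ⟨e2, _⟩ | ⟨e2, _⟩ <;>
  rcases max_cases (a s) (b q) with ⟨e3, _⟩ | ⟨e3, _⟩ <;>
  rcases max_cases (a s') (b q') with ⟨e4, _⟩ | ⟨e4, _⟩ <;> linarith

/-- The componentwise minimum of two index sets. -/
def idxMin {k : ℕ} (I H : Fin k ↪o Fin r) : Fin k ↪o Fin r :=
  OrderEmbedding.ofStrictMono (fun s => min (I s) (H s)) fun _ _ h =>
    min_lt_min (I.strictMono h) (H.strictMono h)

theorem idxMin_apply {k : ℕ} (I H : Fin k ↪o Fin r) (s : Fin k) :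
    idxMin I H s = min (I s) (H s) := rfl

theorem idxMin_le_left {k : ℕ} (I H : Fin k ↪o Fin r) : IdxLE (idxMin I H) I :=
  fun _ => min_le_left _ _

theorem idxMin_le_right {k : ℕ} (I H : Fin k ↪o Fin r) : IdxLE (idxMin I H) H :=
  fun _ => min_le_right _ _

/-! ### Minors under admissible transformations -/

/-- A lower bound for the minors in each set of rows, with the monotonicity and gap properties of
generic matrices, is preserved by transformations that are `μ`-admissible on the left. -/
theorem le_ord_minor_of_admissible {μ : Fin r → ℝ} (hμ : Antitone μ)
    {X B Y : Matrix (Fin r) (Fin r) (SparseField K)}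
    (hX : ∀ i j, 0 ≤ ord (X i j)) (hX' : ∀ i j, ((μ j - μ i : ℝ) : WithTop ℝ) ≤ ord (X i j))
    (hY : ∀ i j, 0 ≤ ord (Y i j)) {k : ℕ} (g : (Fin k ↪o Fin r) → WithTop ℝ)
    (hg : ∀ I J : Fin k ↪o Fin r, g I ≤ ord (minor B I J))
    (hmono : ∀ I H, IdxLE I H → g I ≤ g H)
    (hgap : ∀ I H, IdxLE I H → g H ≤ g I + ((wt μ I - wt μ H : ℝ) : WithTop ℝ))
    (I J : Fin k ↪o Fin r) :
    g I ≤ ord (minor (X * B * Y) I J) := by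
  refine le_ord_det_mul_integral _ _ hY I _ (fun f => ?_) J
  refine le_ord_det_submatrix_mul _ _ _ _ _ fun h hinj => ?_
  obtain ⟨H, σ, e⟩ := exists_orderEmb_perm h hinj
  have h1 : g H ≤ ord (B.submatrix h f).det := by
    rw [show h = fun s => H (σ s) from funext e, ord_det_submatrix_perm_left]
    exact le_ord_det_of_minor_cols _ _ _ (hg H) f
  -- An entry of X in row i and column h has order at least max(μ_i, μ_h) − μ_i; rearrangement
  -- bounds the sum of these along any matching of I with H.
  have h2 : ((wt μ (idxMin I H) - wt μ I : ℝ) : WithTop ℝ) ≤ ∑ s, ord (X (I s) (h s)) := by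
    have h3 : wt μ (idxMin I H) - wt μ I ≤ ∑ s, (max (μ (I s)) (μ (h s)) - μ (I s)) := by
      rw [Finset.sum_sub_distrib]
      refine sub_le_sub_right ?_ _
      have := sum_max_le_sum_max_perm (fun s => μ (I s)) (fun s => μ (H s))
        (fun s t hst => hμ (I.monotone hst)) (fun s t hst => hμ (H.monotone hst)) σ
      simp only [← e] at this
      refine le_trans (Finset.sum_le_sum fun s _ => ?_) this
      rw [idxMin_apply, hμ.map_min]
    refine (WithTop.coe_le_coe.2 h3).trans ?_
    rw [WithTop.coe_sum]
    refine Finset.sum_le_sum fun s _ => ?_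
    rcases max_cases (μ (I s)) (μ (h s)) with ⟨e1, _⟩ | ⟨e1, _⟩ <;> rw [e1]
    · rw [sub_self]
      exact hX _ _
    · exact hX' _ _
  refine le_trans ?_ (add_le_add h2 h1)
  rw [add_comm]
  -- The gap inequality leads from I down to the minimum of I and H at exactly the cost paid by X;
  -- monotonicity then leads up to H.
  exact (hgap _ _ (idxMin_le_left I H)).trans (add_le_add_left (hmono _ _ (idxMin_le_right I H)) _)

theorem IsLeftAdmissible.le_ord {μ : Fin r → ℝ} {Q : GL (Fin r) (ValRing K)}
    (h : IsLeftAdmissible μ Q) (i j : Fin r) :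
    ((μ j - μ i : ℝ) : WithTop ℝ) ≤ ord (toF Q i j) := by
  obtain ⟨P, hP⟩ := h
  have e : toF Q = D K (-μ) * toF P * D K μ := by
    rw [hP, D_inv]
    calc toF Q = (D K (-μ) * D K μ) * toF Q * (D K (-μ) * D K μ) := by
          rw [D_neg_mul_D, one_mul, mul_one]
      _ = _ := by simp only [mul_assoc]
  rw [e]
  simp only [D, Matrix.mul_diagonal, Matrix.diagonal_mul, ord_mul, ord_tPow]
  rw [add_right_comm, ← WithTop.coe_add, Pi.neg_apply, neg_add_eq_sub]
  exact le_add_of_nonneg_right (ord_toF_nonneg P i j)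

theorem IsLeftAdmissible.mul {μ : Fin r → ℝ} {Q Q' : GL (Fin r) (ValRing K)}
    (h : IsLeftAdmissible μ Q) (h' : IsLeftAdmissible μ Q') : IsLeftAdmissible μ (Q * Q') := by
  obtain ⟨P, hP⟩ := h
  obtain ⟨P', hP'⟩ := h'
  refine ⟨P * P', ?_⟩
  rw [toF_mul, toF_mul, hP, hP', D_inv]
  calc _ = D K μ * toF Q * (D K (-μ) * D K μ) * toF Q' * D K (-μ) := by simp only [mul_assoc]
    _ = _ := by rw [D_neg_mul_D, mul_one]; simp only [mul_assoc]

theorem toF_inv (P : GL (Fin r) (ValRing K)) : toF P⁻¹ = (toF P)⁻¹ :=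
  (Matrix.inv_eq_right_inv (toF_mul_inv P)).symm

theorem IsLeftAdmissible.inv {μ : Fin r → ℝ} {Q : GL (Fin r) (ValRing K)}
    (h : IsLeftAdmissible μ Q) : IsLeftAdmissible μ Q⁻¹ := by
  obtain ⟨P, hP⟩ := h
  refine ⟨P⁻¹, ?_⟩
  rw [toF_inv, hP]
  refine Matrix.inv_eq_right_inv ?_
  rw [D_inv]
  calc _ = D K μ * toF Q * (D K (-μ) * D K μ) * toF Q⁻¹ * D K (-μ) := by simp only [mul_assoc]
    _ = D K μ * (toF Q * toF Q⁻¹) * D K (-μ) := by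
      rw [D_neg_mul_D, mul_one]; simp only [mul_assoc]
    _ = 1 := by rw [toF_mul_inv, mul_one, D_mul_D_neg]

theorem hasInv_D {μ : Fin r → ℝ} (hμ : Antitone μ) : HasInv (D K μ) μ :=
  hasInv_iff.2 ⟨hμ, MatEquiv.refl _⟩

/-- A generic matrix in the orbit of `(D_μ, N)` arises from `N` by admissible transformations. -/
theorem exists_admissible_of_pairEquiv {μ μ' : Fin r → ℝ} (hμ : Antitone μ) (hμ' : Antitone μ')
    {N N' A : Matrix (Fin r) (Fin r) (SparseField K)} (h : PairEquiv (D K μ) N (D K μ') N')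
    (hA : IsMuGeneric μ' N' A) :
    μ' = μ ∧ ∃ Q T : GL (Fin r) (ValRing K), IsLeftAdmissible μ Q ∧
      A = toF Q * N * toF T⁻¹ := by
  obtain ⟨P, Q, T, h1, rfl⟩ := h
  obtain rfl : μ' = μ := HasInv.unique ⟨hμ', P, Q, h1.symm⟩ (hasInv_D hμ)
  obtain ⟨Q', T', -, -, -, -, rfl, hQ', -⟩ := hA.factor
  refine ⟨rfl, Q' * Q, T' * T, hQ'.mul ⟨P, ?_⟩, ?_⟩
  -- An equivalence fixing the first member D_μ of the pair says precisely that its middle factor Q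
  -- is admissible.
  · have h2 : D K μ' * toF Q = toF P * D K μ' := by
      conv_lhs => rw [h1, mul_assoc, toF_inv_mul, mul_one]
    rw [h2, D_inv, mul_assoc, D_mul_D_neg, mul_one]
  · rw [mul_inv_rev, toF_mul, toF_mul]
    simp only [mul_assoc]

/-! ### Minors of triangular matrices -/

theorem minor_transpose {k : ℕ} (W : Matrix (Fin r) (Fin r) (SparseField K))
    (I J : Fin k ↪o Fin r) : minor W.transpose I J = minor W J I := by
  rw [minor, ← Matrix.transpose_submatrix, Matrix.det_transpose, minor]

/-- If I s > J s, a permutation cannot send the s+1 indices up to s into the s indices before s. So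
every term of the determinant contains an entry below the diagonal. -/
theorem IsUpper.minor_eq_zero {k : ℕ} {W : Matrix (Fin r) (Fin r) (SparseField K)}
    (hW : IsUpper W) {I J : Fin k ↪o Fin r} (h : ¬ IdxLE I J) : minor W I J = 0 := by
  simp only [IdxLE, not_forall, not_le] at h
  obtain ⟨s, hs⟩ := h
  rw [minor, Matrix.det_apply']
  refine Finset.sum_eq_zero fun σ _ => ?_
  obtain ⟨t, ht, ht'⟩ : ∃ t, t ≤ s ∧ s ≤ σ t := by
    by_contra! hcon
    have := Finset.card_le_card_of_injOn (s := Finset.Iic s) (t := Finset.Iio s) σ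
      (fun t ht => by
        have := hcon t (by simpa using ht)
        simpa using this) σ.injective.injOn
    rw [Fin.card_Iic, Fin.card_Iio] at this
    omega
  rw [Finset.prod_eq_zero (Finset.mem_univ t), mul_zero]
  exact hW _ _ (((J.monotone ht).trans_lt hs).trans_le (I.monotone ht'))

theorem IsLower.minor_eq_zero {k : ℕ} {W : Matrix (Fin r) (Fin r) (SparseField K)}
    (hW : IsLower W) {I J : Fin k ↪o Fin r} (h : ¬ IdxLE J I) : minor W I J = 0 := by
  rw [← minor_transpose]
  exact IsUpper.minor_eq_zero (W := W.transpose) (fun i j hij => hW j i hij) h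

theorem isLower_toF {L : GL (Fin r) (ValRing K)} (h : IsLower L.val) : IsLower (toF L) := by
  intro i j hij
  rw [toF, Matrix.map_apply, h i j hij]
  rfl

/-- The determinants of L and of its inverse have nonnegative orders that add up to 0. -/
theorem ord_det_toF (L : GL (Fin r) (ValRing K)) : ord (toF L).det = 0 := by
  have h := ord_mul (toF L).det (toF L⁻¹).det
  rw [← Matrix.det_mul, toF_mul_inv, Matrix.det_one, ord_one] at h
  exact ((add_eq_zero_iff_of_nonneg (ord_det_nonneg _ (ord_toF_nonneg L))
    (ord_det_nonneg _ (ord_toF_nonneg L⁻¹))).1 h.symm).1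

theorem ord_diag_of_isLower {L : GL (Fin r) (ValRing K)} (h : IsLower L.val) (i : Fin r) :
    ord (toF L i i) = 0 := by
  have h1 := ord_det_toF L
  rw [Matrix.det_of_isLowerTriangular _ (fun i j hij => isLower_toF h i j hij), ord_prod,
    Finset.sum_eq_zero_iff_of_nonneg fun j _ => ord_toF_nonneg L j j] at h1
  exact h1 i (Finset.mem_univ i)

theorem ord_principal_minor {L : GL (Fin r) (ValRing K)} (h : IsLower L.val) {k : ℕ}
    (I : Fin k ↪o Fin r) : ord (minor (toF L) I I) = 0 := by
  rw [minor, Matrix.det_of_isLowerTriangular ((toF L).submatrix I I)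
    (fun i j hij => isLower_toF h (I i) (I j) (I.strictMono hij)), ord_prod]
  exact Finset.sum_eq_zero fun s _ => ord_diag_of_isLower h (I s)

theorem minor_mul_D {k : ℕ} (w : Fin r → ℝ) (W : Matrix (Fin r) (Fin r) (SparseField K))
    (I J : Fin k ↪o Fin r) :
    ord (minor (W * D K w) I J) = (wt w J : WithTop ℝ) + ord (minor W I J) := by
  have := minor_D_mul_mul_D 0 w W I J
  have h0 : D K (0 : Fin r → ℝ) = 1 := by
    rw [D, ← Matrix.diagonal_one]
    rfl
  rw [h0, one_mul] at this
  rw [minor, this]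
  simp [wt, minor]

/-! ### Minors of the generic matrix `L` -/

/-- The inequalities between minors of a generic lower triangular matrix. -/
structure MinorIneq (μ ν : Fin r → ℝ) (L : GL (Fin r) (ValRing K)) : Prop where
  lower : IsLower L.val
  row : ∀ (k : ℕ) (I H J : Fin k ↪o Fin r), IdxLE J I → IdxLE I H →
    ord (minor (toF L) I J) ≤ ord (minor (toF L) H J)
  rowGap : ∀ (k : ℕ) (I H J : Fin k ↪o Fin r), IdxLE J I → IdxLE I H →
    ord (minor (toF L) H J) ≤
      ord (minor (toF L) I J) + ((wt μ I - wt μ H : ℝ) : WithTop ℝ)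
  col : ∀ (k : ℕ) (I H J : Fin k ↪o Fin r), IdxLE H J → IdxLE J I →
    ord (minor (toF L) I J) ≤ ord (minor (toF L) I H)
  colGap : ∀ (k : ℕ) (I H J : Fin k ↪o Fin r), IdxLE H J → IdxLE J I →
    ord (minor (toF L) I H) ≤
      ord (minor (toF L) I J) + ((wt (hat ν) J - wt (hat ν) H : ℝ) : WithTop ℝ)

/-- Triangularity and the four inequalities form a notion stable under reflection in the
antidiagonal, as part (b) requires. -/
theorem IsMuNuGeneric.minorIneq {μ ν : Fin r → ℝ} {L : GL (Fin r) (ValRing K)}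
    (h : IsMuNuGeneric μ ν L) : MinorIneq μ ν L :=
  ⟨h.lower, h.row, h.rowGap, h.col, h.colGap⟩

/-- The order of a minor of `L`, as a real number. -/
noncomputable def minorOrd (L : GL (Fin r) (ValRing K)) {k : ℕ} (I J : Fin k ↪o Fin r) : ℝ :=
  (minor (toF L) I J : HahnSeries ℝ K).order

theorem IdxLE.trans {k : ℕ} {I J H : Fin k ↪o Fin r} (h : IdxLE I J) (h' : IdxLE J H) :
    IdxLE I H := fun s => (h s).trans (h' s)

theorem IdxLE.rfl {k : ℕ} {I : Fin k ↪o Fin r} : IdxLE I I := fun _ => le_rfl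

namespace MinorIneq

variable {μ ν : Fin r → ℝ} {L : GL (Fin r) (ValRing K)}

/-- The principal minor on J has order 0, so the row gap from J to I bounds the order by a finite
number and the minor is not zero. -/
theorem ord_minor (h : MinorIneq μ ν L) {k : ℕ} {I J : Fin k ↪o Fin r} (hJI : IdxLE J I) :
    ord (minor (toF L) I J) = (minorOrd L I J : WithTop ℝ) := by
  refine (coe_order fun h0 => ?_).symm
  have := h.rowGap k J I J IdxLE.rfl hJI
  rw [h0, ord_zero, ord_principal_minor h.lower, zero_add, top_le_iff] at this
  exact WithTop.coe_ne_top this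

theorem minorOrd_rowGap (h : MinorIneq μ ν L) {k : ℕ} {I H J : Fin k ↪o Fin r} (h1 : IdxLE J I)
    (h2 : IdxLE I H) : minorOrd L H J + wt μ H ≤ minorOrd L I J + wt μ I := by
  have := h.rowGap k I H J h1 h2
  rw [h.ord_minor h1, h.ord_minor (h1.trans h2), ← WithTop.coe_add, WithTop.coe_le_coe] at this
  linarith

theorem minorOrd_col (h : MinorIneq μ ν L) {k : ℕ} {I H J : Fin k ↪o Fin r} (h1 : IdxLE H J)
    (h2 : IdxLE J I) : minorOrd L I J ≤ minorOrd L I H := by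
  have := h.col k I H J h1 h2
  rwa [h.ord_minor h2, h.ord_minor (h1.trans h2), WithTop.coe_le_coe] at this

theorem minorOrd_colGap (h : MinorIneq μ ν L) {k : ℕ} {I H J : Fin k ↪o Fin r} (h1 : IdxLE H J)
    (h2 : IdxLE J I) :
    minorOrd L I H + wt (hat ν) H ≤ minorOrd L I J + wt (hat ν) J := by
  have := h.colGap k I H J h1 h2
  rw [h.ord_minor h2, h.ord_minor (h1.trans h2), ← WithTop.coe_add, WithTop.coe_le_coe] at this
  linarith

/-- Minors of `A` in the right-most columns agree in order with minors of `L D_ν̂` in the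
left-most columns. -/
theorem ord_minor_generic (h : MinorIneq μ ν L) (hμ : Antitone μ)
    {A : Matrix (Fin r) (Fin r) (SparseField K)} {Q T : GL (Fin r) (ValRing K)}
    (hQ : IsLeftAdmissible μ Q) (hA : A = toF Q * (toF L * D K (hat ν)) * toF T⁻¹)
    {N' : Matrix (Fin r) (Fin r) (SparseField K)} (hgen : IsMuGeneric μ N' A) {a k : ℕ}
    (hk : a + k = r) (h0k : 0 + k ≤ r) (I : Fin k ↪o Fin r) :
    ord (minor A I (seg a k hk.le)) =
      ((minorOrd L I (seg 0 k h0k) + wt (hat ν) (seg 0 k h0k) : ℝ) : WithTop ℝ) := by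
  apply le_antisymm
  -- In each row set the right-most columns of A give the least order, by `col`; that row-wise bound
  -- is transported from A back to L D_ν̂.
  · have hB : toF L * D K (hat ν) = toF Q⁻¹ * A * toF T := by
      rw [hA]
      calc _ = (toF Q⁻¹ * toF Q) * (toF L * D K (hat ν)) * (toF T⁻¹ * toF T) := by
            rw [toF_inv_mul, toF_inv_mul, one_mul, mul_one]
        _ = _ := by simp only [mul_assoc]
    have := le_ord_minor_of_admissible hμ (ord_toF_nonneg Q⁻¹) hQ.inv.le_ord (ord_toF_nonneg T)
      (fun I => ord (minor A I (seg a k hk.le)))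
      (fun I J => by
        by_cases hIJ : IdxLE I J
        · exact hgen.col k I J _ hIJ (idxLE_seg_last hk J)
        · rw [hgen.upper.minor_eq_zero hIJ, ord_zero]
          exact le_top)
      (fun I H hIH => hgen.row k I H _ hIH (idxLE_seg_last hk H))
      (fun I H hIH => hgen.gap k I H _ hIH (idxLE_seg_last hk H)) I (seg 0 k h0k)
    rw [← hB, minor_mul_D, h.ord_minor (idxLE_seg_zero h0k I), ← WithTop.coe_add,
      add_comm (wt _ _)] at this
    exact this
  -- Conversely, `colGap` makes the left-most columns of L D_ν̂ minimal in each row set, and this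
  -- bound is transported to A.
  · rw [hA]
    refine le_ord_minor_of_admissible hμ (ord_toF_nonneg Q) hQ.le_ord (ord_toF_nonneg T⁻¹)
      (fun I => ((minorOrd L I (seg 0 k h0k) + wt (hat ν) (seg 0 k h0k) : ℝ) : WithTop ℝ))
      (fun I J => ?_) (fun I H hIH => ?_) (fun I H hIH => ?_) I _
    · rw [minor_mul_D]
      by_cases hJI : IdxLE J I
      · rw [h.ord_minor hJI, ← WithTop.coe_add, WithTop.coe_le_coe]
        have := h.minorOrd_colGap (idxLE_seg_zero h0k J) hJI
        linarith
      · rw [(isLower_toF h.lower).minor_eq_zero hJI, ord_zero, WithTop.add_top]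
        exact le_top
    · have := h.row k I H _ (idxLE_seg_zero h0k I) hIH
      rw [h.ord_minor (idxLE_seg_zero h0k I), h.ord_minor (idxLE_seg_zero h0k H),
        WithTop.coe_le_coe] at this
      exact WithTop.coe_le_coe.2 (by linarith)
    · have := h.minorOrd_rowGap (idxLE_seg_zero h0k I) hIH
      rw [← WithTop.coe_add]
      exact WithTop.coe_le_coe.2 (by linarith)

end MinorIneq

/-! ### Omitting consecutive rows -/

/-- The index set that omits the indices from `p` to `q - 1` (zero-based). -/
def omitSeg {p q n : ℕ} (hpq : p ≤ q) (h : q + n = r) : Fin (p + n) ↪o Fin r :=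
  OrderEmbedding.ofStrictMono
    (fun s => ⟨if s.val < p then s.val else q + (s.val - p), by split_ifs <;> omega⟩)
    fun s t hst => by
      simp only [Fin.lt_def] at hst ⊢
      split_ifs <;> omega

theorem val_omitSeg {p q n : ℕ} (hpq : p ≤ q) (h : q + n = r) (s : Fin (p + n)) :
    (omitSeg hpq h s).val = if s.val < p then s.val else q + (s.val - p) := rfl

/-- Row numbers are one-based, so a range starting at 0 omits the same rows as one starting at 1.
Such a range occurs in the partial sums on the diagonal i = j. -/
theorem keptRows_zero (q : ℕ) : keptRows r 0 q = keptRows r 1 q := by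
  ext s
  simp only [keptRows, Finset.mem_filter]
  refine and_congr_right fun _ => not_congr ?_
  omega

theorem keptRows_eq_map {p q n : ℕ} (hpq : p ≤ q) (h : q + n = r) :
    keptRows r (p + 1) q = Finset.univ.map (omitSeg hpq h).toEmbedding := by
  ext s
  simp only [keptRows, Finset.mem_filter, Finset.mem_univ, true_and, Finset.mem_map]
  constructor
  · intro hs
    have := s.isLt
    refine ⟨⟨if s.val < p then s.val else p + (s.val - q), by split_ifs <;> omega⟩, ?_⟩
    apply Fin.ext
    change (omitSeg hpq h _).val = _
    rw [val_omitSeg]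
    simp only
    split_ifs <;> omega
  · rintro ⟨t, rfl⟩
    change ¬ (p + 1 ≤ (omitSeg hpq h t).val + 1 ∧ (omitSeg hpq h t).val + 1 ≤ q)
    rw [val_omitSeg]
    split_ifs <;> omega

theorem omitOrd_eq_of_card {A : Matrix (Fin r) (Fin r) (SparseField K)} {p q a k : ℕ}
    (hk : (keptRows r p q).card = k) (I : Fin k ↪o Fin r) (hI : ∀ s, I s ∈ keptRows r p q)
    (h : a + k = r) :
    omitOrd A p q = (minor A I (seg a k h.le) : HahnSeries ℝ K).order := by
  subst hk
  have : I = (keptRows r p q).orderEmbOfFin rfl := by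
    apply DFunLike.coe_injective
    exact Finset.orderEmbOfFin_unique rfl hI I.strictMono
  rw [omitOrd, ← this, lastCols_eq_seg _ h]

/-- Omitting the one-based rows p + 1, …, q is omitting the zero-based rows p, …, q − 1. -/
theorem omitOrd_succ {A : Matrix (Fin r) (Fin r) (SparseField K)} {p q n a : ℕ}
    (hpq : p ≤ q) (h : q + n = r) (ha : a + (p + n) = r) :
    omitOrd A (p + 1) q =
      (minor A (omitSeg hpq h) (seg a (p + n) ha.le) : HahnSeries ℝ K).order := by
  refine omitOrd_eq_of_card ?_ _ (fun s => ?_) ha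
  · rw [keptRows_eq_map hpq h, Finset.card_map, Finset.card_univ, Fintype.card_fin]
  · rw [keptRows_eq_map hpq h]
    exact Finset.mem_map_of_mem _ (Finset.mem_univ s)

/-- The submatrix is block lower triangular, and its upper left block is a principal block of L,
whose determinant has order 0. -/
theorem ord_minor_omitSeg {L : GL (Fin r) (ValRing K)} (hL : IsLower L.val) {p q n : ℕ}
    (hpq : p ≤ q) (h : q + n = r) (h0 : 0 + (p + n) ≤ r) (hp : p + n ≤ r) :
    ord (minor (toF L) (omitSeg hpq h) (seg 0 (p + n) h0)) =
      ord (minor (toF L) (seg q n h.le) (seg p n hp)) := by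
  have e : ((toF L).submatrix (omitSeg hpq h) (seg 0 (p + n) h0)).submatrix
      finSumFinEquiv finSumFinEquiv =
      Matrix.fromBlocks ((toF L).submatrix (seg 0 p (by omega)) (seg 0 p (by omega))) 0
        ((toF L).submatrix (seg q n h.le) (seg 0 p (by omega)))
        ((toF L).submatrix (seg q n h.le) (seg p n hp)) := by
    have r1 : ∀ s : Fin p, omitSeg hpq h (Fin.castAdd n s) = seg 0 p (by omega) s := fun s => by
      apply Fin.ext
      rw [val_omitSeg, val_seg]
      simp
    have r2 : ∀ s : Fin n, omitSeg hpq h (Fin.natAdd p s) = seg q n h.le s := fun s => by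
      apply Fin.ext
      rw [val_omitSeg, val_seg]
      simp
    have c1 : ∀ s : Fin p, seg 0 (p + n) h0 (Fin.castAdd n s) = seg 0 p (by omega) s := fun s => by
      apply Fin.ext
      simp
    have c2 : ∀ s : Fin n, seg 0 (p + n) h0 (Fin.natAdd p s) = seg p n hp s := fun s => by
      apply Fin.ext
      simp
    refine Matrix.ext fun i j => ?_
    rcases i with i | i <;> rcases j with j | j <;>
      simp only [Matrix.submatrix_apply, finSumFinEquiv_apply_left, finSumFinEquiv_apply_right,
        Matrix.fromBlocks_apply₁₁, Matrix.fromBlocks_apply₁₂, Matrix.fromBlocks_apply₂₁,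
        Matrix.fromBlocks_apply₂₂, r1, r2, c1, c2]
    refine isLower_toF hL _ _ (Fin.lt_def.2 ?_)
    rw [val_seg, val_seg]
    omega
  rw [minor, ← Matrix.det_submatrix_equiv_self finSumFinEquiv, e, Matrix.det_fromBlocks_zero₁₂,
    ord_mul]
  have := ord_principal_minor hL (seg 0 p (by omega))
  rw [minor] at this
  rw [this, zero_add, minor]

/-! ### Invariants of `D_μ L D_w` for truncated weights -/

theorem det_D_mul_toF_mul_D_ne_zero (μ w : Fin r → ℝ) (L : GL (Fin r) (ValRing K)) :
    (D K μ * toF L * D K w).det ≠ 0 := by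
  rw [Matrix.det_mul, Matrix.det_mul]
  exact mul_ne_zero (mul_ne_zero (det_D_ne_zero μ) (det_toF_ne_zero L)) (det_D_ne_zero w)

/-- `w` is obtained from `n` by putting `α` at the position `p` and zeros before it. -/
structure IsTrunc (n w : Fin r → ℝ) (p : Fin r) (α : ℝ) : Prop where
  mono : Monotone n
  nonneg : ∀ q, 0 ≤ n q
  lt : ∀ q, q < p → w q = 0
  eq : w p = α
  gt : ∀ q, p < q → w q = n q
  nonneg_param : 0 ≤ α
  le_param : α ≤ n p

namespace IsTrunc

variable {n w : Fin r → ℝ} {p : Fin r} {α : ℝ}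

theorem le (h : IsTrunc n w p α) (q : Fin r) : w q ≤ n q := by
  rcases lt_trichotomy q p with hq | rfl | hq
  · rw [h.lt q hq]
    exact h.nonneg q
  · rw [h.eq]
    exact h.le_param
  · exact (h.gt q hq).le

/-- The difference n − w is nonnegative and vanishes beyond p, so an index set containing everything
up to p collects all of it. -/
theorem wt_sub_le_first (h : IsTrunc n w p α) {k : ℕ} (hk : p.val < k) (h0 : 0 + k ≤ r)
    (J : Fin k ↪o Fin r) :
    wt n J - wt w J ≤ wt n (seg 0 k h0) - wt w (seg 0 k h0) := by
  have e : ∀ I : Fin k ↪o Fin r, wt n I - wt w I =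
      ∑ q ∈ Finset.univ.map I.toEmbedding, (n q - w q) := fun I => by
    rw [Finset.sum_map, wt, wt, ← Finset.sum_sub_distrib]
    rfl
  rw [e, e, Finset.sum_subset (Finset.subset_univ (Finset.univ.map (seg 0 k h0).toEmbedding))]
  · exact Finset.sum_le_sum_of_subset_of_nonneg (Finset.subset_univ _)
      fun q _ _ => sub_nonneg.2 (h.le q)
  · intro q _ hq
    have hpq : p < q := by
      by_contra hcon
      apply hq
      rw [not_lt, Fin.le_def] at hcon
      refine Finset.mem_map.2 ⟨⟨q.val, by omega⟩, Finset.mem_univ _, Fin.ext ?_⟩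
      change 0 + q.val = q.val
      omega
    rw [h.gt q hpq, sub_self]

/-- Let s₀ be the first place where J reaches p. The difference n − w is the full n before s₀, at
most n p − α at s₀, and 0 afterwards. The resulting s₀ + 1 terms are dominated by the last s₀ + 1
terms on the right, because n is increasing. -/
theorem wt_sub_add_le (h : IsTrunc n w p α) {k : ℕ} (hk : k ≤ p.val)
    (h1 : p.val + 1 - k + k ≤ r) (J : Fin k ↪o Fin r) (hJ : ∃ s, p ≤ J s) :
    wt n J - wt w J + α ≤ wt n (idxMin J (seg (p.val + 1 - k) k h1)) := by
  obtain ⟨s₀, hs₀, hmin⟩ : ∃ s₀, p ≤ J s₀ ∧ ∀ s, s < s₀ → J s < p := by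
    obtain ⟨s₀, hs, hm⟩ := Set.exists_min_image {s | p ≤ J s} id (Set.toFinite _) hJ
    exact ⟨s₀, hs, fun s hlt => not_le.1 fun hle => not_le.2 hlt (hm s hle)⟩
  have hk0 : NeZero k := ⟨by have := s₀.isLt; omega⟩
  have step1 : wt n J - wt w J + α ≤ ∑ s, if s ≤ s₀ then n (min (J s) p) else 0 := by
    have hα : α = ∑ s, if s = s₀ then α else 0 := by simp
    rw [wt, wt, ← Finset.sum_sub_distrib, hα, ← Finset.sum_add_distrib]
    refine Finset.sum_le_sum fun s _ => ?_
    rcases lt_trichotomy s s₀ with hs | rfl | hs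
    · rw [if_neg hs.ne, if_pos hs.le, h.lt _ (hmin s hs), min_eq_left (hmin s hs).le]
      linarith
    · rw [if_pos rfl, if_pos le_rfl, min_eq_right hs₀]
      rcases hs₀.eq_or_lt with e | hlt
      · rw [← e, h.eq]
        linarith
      · rw [h.gt _ hlt]
        linarith [h.le_param]
    · rw [if_neg hs.ne', if_neg (not_le.2 hs), h.gt _ (hs₀.trans_lt (J.strictMono hs))]
      linarith
  refine step1.trans ?_
  have hc : k - 1 - s₀.val < k := by have := s₀.isLt; omega
  -- A cyclic shift by k − 1 − s₀ moves the places 0, …, s₀ onto the last s₀ + 1 places without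
  -- wrapping around; the places that do wrap carry a zero on the left.
  refine le_trans ?_ (Equiv.sum_comp (Equiv.addRight (⟨k - 1 - s₀.val, hc⟩ : Fin k))
    fun t => n (idxMin J (seg (p.val + 1 - k) k h1) t)).le
  refine Finset.sum_le_sum fun s _ => ?_
  split_ifs with hs
  · have hs' := Fin.le_def.1 hs
    have hs₀' := s₀.isLt
    have hval : (s + ⟨k - 1 - s₀.val, hc⟩ : Fin k).val = s.val + (k - 1 - s₀.val) := by
      rw [Fin.val_add]
      exact Nat.mod_eq_of_lt (by simp only; omega)
    refine h.mono ?_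
    rw [Equiv.coe_addRight, idxMin_apply]
    refine le_min ((min_le_left _ _).trans (J.monotone (Fin.le_def.2 (by rw [hval]; omega)))) ?_
    rw [Fin.le_def, val_seg, hval]
    rcases hs.eq_or_lt with rfl | hlt
    · have := Fin.le_def.1 (min_le_right (J s) p)
      omega
    · have hlt' := Fin.lt_def.1 hlt
      have h2 := add_sub_le_of_lt J (s := s) (t := ⟨s₀.val - 1, by omega⟩)
        (Fin.le_def.2 (by simp only; omega))
      have h3 := Fin.lt_def.1 (hmin ⟨s₀.val - 1, by omega⟩ (Fin.lt_def.2 (by simp only; omega)))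
      have h4 := Fin.le_def.1 (min_le_left (J s) p)
      simp only at h2
      omega
  · exact h.nonneg _

end IsTrunc

namespace MinorIneq

variable {μ ν w : Fin r → ℝ} {L : GL (Fin r) (ValRing K)} {p : Fin r} {α : ℝ}

/-- The minimal order of minors of `D_μ L D_w` is attained in the last rows. -/
theorem wt_inv_eq (h : MinorIneq μ ν L) (w : Fin r → ℝ) {a k : ℕ} (hk : a + k = r) (c : ℝ)
    (hle : ∀ J : Fin k ↪o Fin r, c ≤ minorOrd L (seg a k hk.le) J + wt w J)
    (hex : ∃ J : Fin k ↪o Fin r, minorOrd L (seg a k hk.le) J + wt w J ≤ c) :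
    wt (inv (D K μ * toF L * D K w)) (seg a k hk.le) = wt μ (seg a k hk.le) + c := by
  refine wt_seg_eq_of_minors (hasInv_inv (det_D_mul_toF_mul_D_ne_zero μ w L)) hk _
    (fun I J => ?_) ?_
  · rw [minor, minor_D_mul_mul_D]
    by_cases hJI : IdxLE J I
    · have h1 := h.ord_minor hJI
      rw [minor] at h1
      rw [h1, ← WithTop.coe_add, WithTop.coe_le_coe]
      have h2 := h.minorOrd_rowGap hJI (idxLE_seg_last hk I)
      have h3 := hle J
      simp only [wt] at *
      linarith
    · have h1 := (isLower_toF h.lower).minor_eq_zero hJI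
      rw [minor] at h1
      rw [h1, ord_zero, WithTop.add_top]
      exact le_top
  · obtain ⟨J, hJ⟩ := hex
    refine ⟨seg a k hk.le, J, ?_⟩
    have h1 := h.ord_minor (idxLE_seg_last hk J)
    rw [minor] at h1
    rw [minor, minor_D_mul_mul_D, h1, ← WithTop.coe_add, WithTop.coe_le_coe]
    simp only [wt] at *
    linarith

/-- By `colGap` the first k columns are optimal for the full weight, and passing from the full to
the truncated weight favours them further. -/
theorem wt_inv_of_lt (h : MinorIneq μ ν L) (hw : IsTrunc (hat ν) w p α) {a k : ℕ}
    (hk : a + k = r) (h0 : 0 + k ≤ r) (hpk : p.val < k) :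
    wt (inv (D K μ * toF L * D K w)) (seg a k hk.le) = wt μ (seg a k hk.le) +
      (minorOrd L (seg a k hk.le) (seg 0 k h0) + wt w (seg 0 k h0)) := by
  refine h.wt_inv_eq w hk _ (fun J => ?_) ⟨_, le_rfl⟩
  have h1 := h.minorOrd_colGap (idxLE_seg_zero h0 J) (idxLE_seg_last hk J)
  have h2 := hw.wt_sub_le_first hpk h0 J
  linarith

theorem minorOrd_self (h : MinorIneq μ ν L) {k : ℕ} (I : Fin k ↪o Fin r) :
    minorOrd L I I = 0 := order_eq_of_ord_eq (ord_principal_minor h.lower I)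

/-- A column set lying before p is dominated by the block ending just before p, by `col`. Any other
J is compared with the block ending at p: `colGap` leads to their componentwise minimum, `col` leads
on to the block, and `wt_sub_add_le` accounts for the weights. -/
theorem wt_inv_of_le (h : MinorIneq μ ν L) (hw : IsTrunc (hat ν) w p α) {a k : ℕ}
    (hk : a + k = r) (h0 : p.val - k + k ≤ r) (h1 : p.val + 1 - k + k ≤ r) (hpk : k ≤ p.val) :
    wt (inv (D K μ * toF L * D K w)) (seg a k hk.le) = wt μ (seg a k hk.le) +
      min (minorOrd L (seg a k hk.le) (seg (p.val - k) k h0))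
        (minorOrd L (seg a k hk.le) (seg (p.val + 1 - k) k h1) + α) := by
  -- For k = 0 the second block is empty and does not have weight α; the formula still holds since α
  -- ≥ 0.
  rcases Nat.eq_zero_or_pos k with rfl | hpos
  · have hs : ∀ I J : Fin 0 ↪o Fin r, I = J := fun I J =>
      DFunLike.ext _ _ fun s => s.elim0
    have hz : ∀ I J : Fin 0 ↪o Fin r, minorOrd L I J = 0 := fun I J => by
      rw [hs I J]
      exact h.minorOrd_self J
    rw [hz, hz, zero_add, min_eq_left hw.nonneg_param]
    simp [wt]
  have hw0 : ∀ s, w (seg (p.val - k) k h0 s) = 0 := fun s => hw.lt _ (by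
    have := s.isLt
    rw [Fin.lt_def, val_seg]
    omega)
  have e0 : wt w (seg (p.val - k) k h0) = 0 := Finset.sum_eq_zero fun s _ => hw0 s
  have e1 : wt w (seg (p.val + 1 - k) k h1) = α := by
    rw [wt, Finset.sum_eq_single (⟨k - 1, by omega⟩ : Fin k)]
    · rw [← hw.eq]
      congr 1
      apply Fin.ext
      rw [val_seg]
      simp only
      omega
    · intro s _ hs
      have hs' : s.val ≠ k - 1 := fun e => hs (Fin.ext e)
      have := s.isLt
      refine hw.lt _ ?_
      rw [Fin.lt_def, val_seg]
      omega
    · intro hn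
      exact absurd (Finset.mem_univ _) hn
  refine h.wt_inv_eq w hk _ (fun J => ?_) ?_
  · by_cases hJ : ∃ s, p ≤ J s
    · refine (min_le_right _ _).trans ?_
      have h2 := hw.wt_sub_add_le hpk h1 J hJ
      have h3 := h.minorOrd_colGap (idxMin_le_left J (seg (p.val + 1 - k) k h1))
        (idxLE_seg_last hk J)
      have h4 := h.minorOrd_col (idxMin_le_right J (seg (p.val + 1 - k) k h1))
        (idxLE_seg_last hk _)
      linarith
    · push Not at hJ
      refine (min_le_left _ _).trans ?_
      have e : wt w J = 0 := Finset.sum_eq_zero fun s _ => hw.lt _ (hJ s)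
      rw [e, add_zero]
      refine h.minorOrd_col (fun s => ?_) (idxLE_seg_last hk _)
      have hs := s.isLt
      have h2 := add_sub_le_of_lt J (s := s) (t := ⟨k - 1, by omega⟩)
        (Fin.le_def.2 (by simp only; omega))
      have h3 := Fin.lt_def.1 (hJ ⟨k - 1, by omega⟩)
      rw [Fin.le_def, val_seg]
      simp only at h2
      omega
  · rcases min_cases (minorOrd L (seg a k hk.le) (seg (p.val - k) k h0))
      (minorOrd L (seg a k hk.le) (seg (p.val + 1 - k) k h1) + α) with ⟨e, _⟩ | ⟨e, _⟩ <;> rw [e]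
    · exact ⟨_, by rw [e0, add_zero]⟩
    · exact ⟨_, by rw [e1]⟩

end MinorIneq

/-! ### The right filling in terms of the minors of `L` -/

/-- The order of the minor of `L` with the last `r - q` rows and with `r - q` consecutive columns,
the first of which has (zero-based) number `p`. -/
noncomputable def segOrd (L : GL (Fin r) (ValRing K)) (p q : ℕ) : ℝ :=
  if h : p ≤ q ∧ q ≤ r then
    minorOrd L (seg q (r - q) (by omega)) (seg p (r - q) (by omega)) else 0

theorem minorOrd_seg (L : GL (Fin r) (ValRing K)) {p q n : ℕ} (h : q + n = r) (hp : p + n ≤ r) :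
    minorOrd L (seg q n h.le) (seg p n hp) = segOrd L p q := by
  obtain rfl : n = r - q := by omega
  rw [segOrd, dif_pos ⟨by omega, by omega⟩]

/-- The sum of the first `m` entries of `w`. -/
noncomputable def headSum (w : Fin r → ℝ) (m : ℕ) : ℝ :=
  if h : 0 + m ≤ r then wt w (seg 0 m h) else 0

theorem headSum_succ (w : Fin r → ℝ) {m : ℕ} (hm : m < r) :
    headSum w (m + 1) = headSum w m + w ⟨m, hm⟩ := by
  rw [headSum, headSum, dif_pos (by omega), dif_pos (by omega), wt, wt, Fin.sum_univ_castSucc]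
  congr 2
  apply Fin.ext
  simp

/-- The largest parameter for which row `j` and the rows below it still grow, when the entry `ν_i`
is being inserted. -/
noncomputable def growthBound (ν : Fin r → ℝ) (L : GL (Fin r) (ValRing K)) (i : Fin r) (j : ℕ) :
    ℝ :=
  if j ≤ i.val then ν i else segOrd L (j - i.val - 1) j - segOrd L (j - i.val) j

namespace MinorIneq

variable {μ ν : Fin r → ℝ} {L : GL (Fin r) (ValRing K)}

theorem segOrd_last (h : MinorIneq μ ν L) (p : ℕ) : segOrd L p r = 0 := by
  by_cases hp : p ≤ r
  · rw [← minorOrd_seg L (n := 0) rfl hp]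
    rw [show seg p 0 hp = seg r 0 le_rfl from DFunLike.ext _ _ fun s => s.elim0]
    exact h.minorOrd_self _
  -- Out of range, the default value 0 agrees with the order of the empty minor.
  · rw [segOrd, dif_neg fun hh => hp hh.1]

theorem growthBound_last (h : MinorIneq μ ν L) (i : Fin r) : growthBound ν L i r = 0 := by
  rw [growthBound, if_neg (not_le.2 i.isLt), h.segOrd_last, h.segOrd_last, sub_zero]

theorem growthBound_nonneg (h : MinorIneq μ ν L) (hν : ∀ q, 0 ≤ ν q) (i : Fin r) {j : ℕ}
    (hj : j ≤ r) : 0 ≤ growthBound ν L i j := by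
  rw [growthBound]
  split_ifs with hji
  · exact hν i
  · rw [sub_nonneg, ← minorOrd_seg L (n := r - j) (by omega) (by omega),
      ← minorOrd_seg L (n := r - j) (by omega) (by omega)]
    refine h.minorOrd_col (fun s => ?_)
      (idxLE_seg_last (Nat.add_sub_cancel' hj) _)
    rw [Fin.le_def, val_seg, val_seg]
    omega

/-- The parameters `p'` and `m` are tied to p and q by equations so that expressions with natural
subtraction can be matched directly. -/
theorem omitOrd_eq (h : MinorIneq μ ν L) (hμ : Antitone μ)
    {A : Matrix (Fin r) (Fin r) (SparseField K)} {Q T : GL (Fin r) (ValRing K)}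
    (hQ : IsLeftAdmissible μ Q) (hA : A = toF Q * (toF L * D K (hat ν)) * toF T⁻¹)
    {N' : Matrix (Fin r) (Fin r) (SparseField K)} (hgen : IsMuGeneric μ N' A) {p p' q m : ℕ}
    (hp' : p' = p + 1) (hpq : p ≤ q) (hq : q ≤ r) (hm : m = p + (r - q)) :
    omitOrd A p' q = segOrd L p q + headSum (hat ν) m := by
  subst hp' hm
  have hn : q + (r - q) = r := by omega
  have h0 : 0 + (p + (r - q)) ≤ r := by omega
  rw [omitOrd_succ (a := q - p) hpq hn (by omega)]
  apply order_eq_of_ord_eq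
  rw [h.ord_minor_generic hμ hQ hA hgen (by omega) h0, headSum, dif_pos h0]
  congr 2
  rw [← minorOrd_seg L hn (by omega), minorOrd, minorOrd]
  apply order_eq_of_ord_eq
  rw [ord_minor_omitSeg h.lower hpq hn h0 (by omega)]
  exact h.ord_minor (idxLE_seg_last hn _)

/-- All four orders in the two partial sums become minors of L plus head sums of ν̂. Off the
diagonal i = j the head sums cancel; on it they leave ν_i, which accounts for the two branches of
`growthBound`. -/
theorem rightFilling_eq (h : MinorIneq μ ν L) (hμ : Antitone μ) {k : Fin r → Fin r → ℝ}
    (hk : IsRightFilling (D K μ) (toF L * D K (hat ν)) k) {i j : Fin r} (hij : i ≤ j) :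
    k i j = growthBound ν L i j.val - growthBound ν L i (j.val + 1) := by
  obtain ⟨μ', N', A, hμ', hpair, hgen, hfill⟩ := hk
  obtain ⟨rfl, Q, T, hQ, hA⟩ := exists_admissible_of_pairEquiv hμ hμ' hpair hgen
  rw [hfill i j hij, partSum, partSum]
  have hj := j.isLt
  rw [Fin.le_def] at hij
  have e3 := h.omitOrd_eq hμ hQ hA hgen (p := j.val - i.val) (p' := j.val + 1 - i.val)
    (q := j.val + 1 - 1) (m := r - i.val) (by omega) (by omega) (by omega) (by omega)
  have e4 := h.omitOrd_eq hμ hQ hA hgen (p := j.val - i.val + 1) (p' := j.val + 1 - i.val + 1)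
    (q := j.val + 1) (m := r - i.val) (by omega) (by omega) (by omega) (by omega)
  have e2 := h.omitOrd_eq hμ hQ hA hgen (p := j.val - i.val) (p' := j.val + 1 - (i.val + 1) + 1)
    (q := j.val + 1) (m := r - i.val - 1) (by omega) (by omega) (by omega) (by omega)
  rw [e2, e3, e4, Nat.add_sub_cancel, growthBound, growthBound,
    if_neg (by omega : ¬ j.val + 1 ≤ i.val),
    show j.val + 1 - i.val - 1 = j.val - i.val by omega,
    show j.val + 1 - i.val = j.val - i.val + 1 by omega]
  rcases hij.eq_or_lt with e | hlt
  · rw [if_pos e.ge]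
    -- On the diagonal the omitted range starts at the nonexistent row 0, so one row fewer is
    -- omitted and the head sum is one term longer.
    have e0 : omitOrd A (j.val + 1 - (i.val + 1)) j.val = omitOrd A 1 j.val := by
      rw [show j.val + 1 - (i.val + 1) = 0 by omega]
      have hcard : r - (keptRows r 1 j.val).card + (keptRows r 1 j.val).card = r :=
        Nat.sub_add_cancel ((Finset.card_le_univ _).trans_eq (Fintype.card_fin r))
      have : omitOrd A 1 j.val = _ := omitOrd_eq_of_card rfl
        ((keptRows r 1 j.val).orderEmbOfFin rfl) (fun s => Finset.orderEmbOfFin_mem _ _ _)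
        hcard
      rw [this]
      refine omitOrd_eq_of_card (by rw [keptRows_zero]) _ (fun s => ?_) hcard
      rw [keptRows_zero]
      exact Finset.orderEmbOfFin_mem _ _ _
    have e1 := h.omitOrd_eq hμ hQ hA hgen (p := 0) (p' := 1)
      (q := j.val) (m := r - i.val) (by omega) (by omega) (by omega) (by omega)
    have hs := headSum_succ (hat ν) (m := r - i.val - 1) (by omega)
    rw [show r - i.val - 1 + 1 = r - i.val by omega] at hs
    have hν : hat ν ⟨r - i.val - 1, by omega⟩ = ν i := by
      rw [hat]
      congr 1
      apply Fin.ext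
      rw [Fin.val_rev]
      simp only
      omega
    rw [hν] at hs
    rw [e0, e1, show j.val - i.val = 0 by omega]
    linarith
  · rw [if_neg (not_le.2 hlt)]
    have e1 := h.omitOrd_eq hμ hQ hA hgen (p := j.val - i.val - 1) (p' := j.val + 1 - (i.val + 1))
      (q := j.val) (m := r - i.val - 1) (by omega) (by omega) (by omega) (by omega)
    rw [e1]
    linarith

/-- The last entry k_rr of the filling is ν_r, the smallest part. -/
theorem nonneg_of_rightFilling (h : MinorIneq μ ν L) (hμ : Antitone μ) (hν : Antitone ν)
    {k : Fin r → Fin r → ℝ} (hk : IsRightFilling (D K μ) (toF L * D K (hat ν)) k)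
    (hpos : ∀ i j, i ≤ j → 0 ≤ k i j) (q : Fin r) : 0 ≤ ν q := by
  let l : Fin r := ⟨r - 1, by have := q.isLt; omega⟩
  have h1 := hpos l l le_rfl
  have hl : l.val + 1 = r := by
    have := q.isLt
    change r - 1 + 1 = r
    omega
  rw [h.rightFilling_eq hμ hk le_rfl, hl, h.growthBound_last, sub_zero, growthBound,
    if_pos le_rfl] at h1
  refine h1.trans (hν (Fin.le_def.2 ?_))
  have := q.isLt
  omega

end MinorIneq

/-! ### Growth of the shapes -/

theorem beforeThen_zero (ν : Fin r → ℝ) (i : Fin r) : beforeThen ν i 0 = before ν i := by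
  rw [beforeThen, Function.update_eq_self_iff, before, if_neg (lt_irrefl i)]

theorem hat_beforeThen_rev (ν : Fin r → ℝ) (i : Fin r) (α : ℝ) :
    hat (beforeThen ν i α) i.rev = α := by
  rw [hat, Fin.rev_rev, beforeThen, Function.update_self]

theorem hat_beforeThen_of_ne (ν : Fin r → ℝ) (i : Fin r) (α : ℝ) {q : Fin r} (hq : q ≠ i.rev) :
    hat (beforeThen ν i α) q = hat (before ν i) q := by
  rw [hat, beforeThen, Function.update_of_ne, hat]
  intro e
  exact hq (Fin.rev_eq_iff.1 e)

theorem isTrunc_hat {ν : Fin r → ℝ} (hν : Antitone ν) (h0 : ∀ q, 0 ≤ ν q) (i : Fin r) {α : ℝ}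
    (hα : 0 ≤ α) (hαν : α ≤ ν i) : IsTrunc (hat ν) (hat (beforeThen ν i α)) i.rev α where
  mono := fun _ _ h => hν (Fin.rev_le_rev.2 h)
  nonneg := fun q => h0 q.rev
  lt := fun q hq => by
    rw [hat_beforeThen_of_ne _ _ _ hq.ne, hat, before, if_neg]
    rw [not_lt]
    exact (Fin.lt_rev_iff.1 hq).le
  eq := hat_beforeThen_rev ν i α
  gt := fun q hq => by
    rw [hat_beforeThen_of_ne _ _ _ hq.ne', hat, before, if_pos (Fin.rev_lt_iff.1 hq), hat]
  nonneg_param := hα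
  le_param := by rwa [hat, Fin.rev_rev]

theorem wt_hat_beforeThen (ν : Fin r → ℝ) (i : Fin r) (α : ℝ) {k : ℕ} (h0 : 0 + k ≤ r)
    (hk : i.rev.val < k) :
    wt (hat (beforeThen ν i α)) (seg 0 k h0) = wt (hat (before ν i)) (seg 0 k h0) + α := by
  have hseg : seg 0 k h0 ⟨i.rev.val, hk⟩ = i.rev := Fin.ext (by simp)
  have hi : hat (before ν i) i.rev = 0 := by
    rw [hat, Fin.rev_rev, before, if_neg (lt_irrefl i)]
  rw [← sub_eq_iff_eq_add', wt, wt, ← Finset.sum_sub_distrib,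
    Finset.sum_eq_single (⟨i.rev.val, hk⟩ : Fin k)]
  · rw [hseg, hat_beforeThen_rev, hi, sub_zero]
  · intro s _ hs
    rw [hat_beforeThen_of_ne, sub_self]
    intro e
    exact hs ((seg 0 k h0).injective (e.trans hseg.symm))
  · intro hn
    exact absurd (Finset.mem_univ _) hn

namespace MinorIneq

variable {μ ν : Fin r → ℝ} {L : GL (Fin r) (ValRing K)}

/-- For a ≤ i the optimal columns contain the position of the parameter, so the tail sum grows by α.
For a > i the two competing blocks give a minimum; at parameter 0 the second block wins because the
growth bound is nonnegative. -/
theorem wt_shape_sub (h : MinorIneq μ ν L) (hν : Antitone ν) (h0 : ∀ q, 0 ≤ ν q) (i : Fin r)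
    {α : ℝ} (hα : 0 ≤ α) (hαν : α ≤ ν i) {a k : ℕ} (hk : a + k = r) :
    wt (shape μ L (beforeThen ν i α)) (seg a k hk.le) -
      wt (shape μ L (before ν i)) (seg a k hk.le) = min (growthBound ν L i a) α := by
  have hi := i.isLt
  have hp : i.rev.val = r - (i.val + 1) := Fin.val_rev i
  have t1 := isTrunc_hat hν h0 i hα hαν
  have t0 := isTrunc_hat hν h0 i le_rfl (h0 i)
  rw [← beforeThen_zero, shape, shape]
  by_cases hai : a ≤ i.val
  · have h0k : 0 + k ≤ r := by omega
    rw [h.wt_inv_of_lt t1 hk h0k (by omega), h.wt_inv_of_lt t0 hk h0k (by omega),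
      beforeThen_zero, wt_hat_beforeThen ν i α h0k (by omega), growthBound, if_pos hai,
      min_eq_right hαν]
    ring
  · have hb := h.growthBound_nonneg h0 i (j := a) (by omega)
    rw [h.wt_inv_of_le t1 hk (by omega) (by omega) (by omega),
      h.wt_inv_of_le t0 hk (by omega) (by omega) (by omega), minorOrd_seg L hk, minorOrd_seg L hk]
    rw [growthBound, if_neg hai] at hb ⊢
    rw [show i.rev.val - k = a - i.val - 1 by omega, show i.rev.val + 1 - k = a - i.val by omega,
      add_zero, min_eq_right (sub_nonneg.1 hb)]
    rcases le_total (segOrd L (a - i.val - 1) a - segOrd L (a - i.val) a) α with hle | hle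
    · rw [min_eq_left hle, min_eq_left (by linarith)]
      ring
    · rw [min_eq_right hle, min_eq_right (by linarith)]
      ring

theorem shape_sub (h : MinorIneq μ ν L) (hν : Antitone ν) (h0 : ∀ q, 0 ≤ ν q) (i : Fin r)
    {α : ℝ} (hα : 0 ≤ α) (hαν : α ≤ ν i) (j : Fin r) :
    shape μ L (beforeThen ν i α) j - shape μ L (before ν i) j =
      min (growthBound ν L i j.val) α - min (growthBound ν L i (j.val + 1)) α := by
  obtain ⟨k, hk⟩ : ∃ k, j.val + (k + 1) = r := ⟨r - j.val - 1, by omega⟩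
  have h1 := h.wt_shape_sub hν h0 i hα hαν hk
  have h2 := h.wt_shape_sub hν h0 i hα hαν (a := j.val + 1) (k := k) (by omega)
  rw [wt_seg_succ, wt_seg_succ] at h1
  rw [← h1, ← h2]
  simp only [Fin.eta]
  ring

/-- Inserting α multiplies the single column `i.rev` by t^α, so the invariants interlace. -/
theorem shape_interlace (i : Fin r) (α : ℝ) {j j' : Fin r} (hj : j < j') :
    shape μ L (beforeThen ν i α) j' ≤ shape μ L (before ν i) j := by
  let d : Fin r → SparseField K := fun q => if q = i.rev then tPow K α else 1
  have e : D K (hat (beforeThen ν i α)) = D K (hat (before ν i)) * Matrix.diagonal d := by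
    rw [D, D, Matrix.diagonal_mul_diagonal]
    congr 1
    funext q
    by_cases hq : q = i.rev
    · subst hq
      have hi : hat (before ν i) i.rev = 0 := by
        rw [hat, Fin.rev_rev, before, if_neg (lt_irrefl i)]
      have hd : d i.rev = tPow K α := if_pos rfl
      rw [hd, hat_beforeThen_rev, hi, tPow_zero, one_mul]
    · have hd : d q = 1 := if_neg hq
      rw [hd, hat_beforeThen_of_ne _ _ _ hq, mul_one]
  have h1 := hasInv_inv (det_D_mul_toF_mul_D_ne_zero μ (hat (before ν i)) L)
  have h2 := hasInv_inv (det_D_mul_toF_mul_D_ne_zero μ (hat (beforeThen ν i α)) L)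
  refine h1.interlace d i.rev (fun q hq => if_neg hq) ?_ hj
  rw [e, ← mul_assoc] at h2
  rw [shape, e, ← mul_assoc]
  exact h2

/-- The bound is constant up to row i, and from there on its successive drops are the entries of the
filling. -/
theorem growthBound_antitone (h : MinorIneq μ ν L) (hμ : Antitone μ) {k : Fin r → Fin r → ℝ}
    (hk : IsRightFilling (D K μ) (toF L * D K (hat ν)) k) (hpos : ∀ i j, i ≤ j → 0 ≤ k i j)
    (i : Fin r) {a b : ℕ} (hab : a ≤ b) (hb : b ≤ r) :
    growthBound ν L i b ≤ growthBound ν L i a := by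
  induction b, hab using Nat.le_induction with
  | base => exact le_rfl
  | succ n hn ih =>
    refine le_trans ?_ (ih (by omega))
    rcases lt_or_ge n i.val with hni | hni
    · rw [growthBound, growthBound, if_pos (by omega), if_pos (by omega)]
    · have := hpos i ⟨n, by omega⟩ (Fin.le_def.2 hni)
      rw [h.rightFilling_eq hμ hk (Fin.le_def.2 hni)] at this
      exact sub_nonneg.1 this

/-- The strips of the right filling, and how they grow. -/
theorem strips_of_rightFilling (h : MinorIneq μ ν L) (hμ : Antitone μ) (hν : Antitone ν)
    {k : Fin r → Fin r → ℝ} (hk : IsRightFilling (D K μ) (toF L * D K (hat ν)) k)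
    (hpos : ∀ i j, i ≤ j → 0 ≤ k i j) (i : Fin r) :
    (∀ j, shape μ L (beforeThen ν i (ν i)) j - shape μ L (before ν i) j =
      if i ≤ j then k i j else 0) ∧
    ∀ α β : ℝ, 0 < α → α < β → β ≤ ν i →
      IsHorizontalStrip (shape μ L (beforeThen ν i α)) (shape μ L (before ν i)) ∧
      IsHorizontalStrip (shape μ L (beforeThen ν i β)) (shape μ L (before ν i)) ∧
      IsInitialSegment (shape μ L (beforeThen ν i α)) (shape μ L (beforeThen ν i β))
        (shape μ L (before ν i)) := by
  have h0 := h.nonneg_of_rightFilling hμ hν hk hpos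
  have hanti := fun {a b : ℕ} => h.growthBound_antitone hμ hk hpos i (a := a) (b := b)
  have hzero : growthBound ν L i 0 = ν i := by rw [growthBound, if_pos (Nat.zero_le _)]
  have hstrip : ∀ α : ℝ, 0 ≤ α → α ≤ ν i →
      IsHorizontalStrip (shape μ L (beforeThen ν i α)) (shape μ L (before ν i)) := by
    intro α hα hαν
    refine ⟨fun j => ?_, fun j j' hj => shape_interlace i α hj⟩
    have h1 := h.shape_sub hν h0 i hα hαν j
    have h2 := min_le_min_right α (hanti (Nat.le_succ j.val) j.isLt)
    simp only [Nat.succ_eq_add_one] at h2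
    linarith
  refine ⟨fun j => ?_, fun α β hα hαβ hβ => ⟨hstrip α hα.le (hαβ.le.trans hβ),
    hstrip β (hα.trans hαβ).le hβ, ?_⟩⟩
  · have hle : ∀ a, a ≤ r → growthBound ν L i a ≤ ν i := fun a ha =>
      (hanti (Nat.zero_le a) ha).trans_eq hzero
    rw [h.shape_sub hν h0 i (h0 i) le_rfl, min_eq_left (hle _ j.isLt.le),
      min_eq_left (hle _ j.isLt)]
    split_ifs with hij
    · exact (h.rightFilling_eq hμ hk hij).symm
    · have := Fin.lt_def.1 (not_le.1 hij)
      rw [growthBound, growthBound, if_pos (by omega), if_pos (by omega), sub_self]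
  -- Let m be the first row whose bound lies below α. It exists because the bound is 0 at r, and it
  -- is positive because the bound at 0 is ν_i > α.
  · have hex : ∃ m, growthBound ν L i m < α := ⟨r, by rwa [h.growthBound_last]⟩
    classical
    have hm := Nat.find_spec hex
    have hmin : ∀ n, n < Nat.find hex → α ≤ growthBound ν L i n := fun n hn =>
      not_lt.1 (Nat.find_min hex hn)
    have hmr : Nat.find hex ≤ r := Nat.find_min' hex (by rwa [h.growthBound_last])
    generalize Nat.find hex = m at hm hmin hmr
    have hm0 : m ≠ 0 := by
      rintro rfl
      rw [hzero] at hm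
      linarith
    have hsα := h.shape_sub hν h0 i hα.le (hαβ.le.trans hβ)
    have hsβ := h.shape_sub hν h0 i (hα.trans hαβ).le hβ
    have hlow : ∀ a, m ≤ a → a ≤ r → growthBound ν L i a ≤ α := fun a h1 h2 =>
      (hanti h1 h2).trans hm.le
    -- Row m − 1 is the growing row: the rows below it are saturated at α, hence also at β, and in
    -- the rows above both truncations equal α.
    refine ⟨⟨m - 1, by omega⟩, fun j hj => ?_, fun j hj => ?_, ?_⟩
    · have hj' := Fin.lt_def.1 hj
      simp only at hj'
      have b1 := hlow j.val (by omega) j.isLt.le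
      have b2 := hlow (j.val + 1) (by omega) j.isLt
      rw [hsα, hsβ, min_eq_left b1, min_eq_left b2, min_eq_left (b1.trans hαβ.le),
        min_eq_left (b2.trans hαβ.le)]
    · have hj' := Fin.lt_def.1 hj
      simp only at hj'
      rw [hsα, min_eq_right (hmin _ (by omega)), min_eq_right (hmin _ (by omega)), sub_self]
    · rw [hsα, hsβ]
      simp only
      rw [Nat.sub_add_cancel (Nat.pos_of_ne_zero hm0), min_eq_left hm.le,
        min_eq_left (hm.le.trans hαβ.le)]
      exact sub_le_sub_right (min_le_min_left _ hαβ.le) _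

end MinorIneq

/-! ### Reflection in the antidiagonal -/

/-- The reflection of an invertible matrix in its antidiagonal. -/
noncomputable def reflect (P : GL (Fin r) (ValRing K)) : GL (Fin r) (ValRing K) :=
  glPerm K Fin.revPerm * glTranspose P * (glPerm K Fin.revPerm)⁻¹

theorem toF_reflect (P : GL (Fin r) (ValRing K)) :
    toF (reflect P) = (toF P).transpose.submatrix Fin.revPerm Fin.revPerm := by
  rw [reflect, toF_mul, toF_mul, toF_glTranspose, toF_glPerm_mul, mul_toF_glPerm_inv,
    Matrix.submatrix_submatrix]
  rfl

theorem isLower_reflect {P : GL (Fin r) (ValRing K)} (h : IsLower P.val) :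
    IsLower (reflect P).val := by
  intro i j hij
  have h1 : toF (reflect P) i j = 0 := by
    rw [toF_reflect]
    exact isLower_toF h _ _ (Fin.rev_lt_rev.2 hij)
  exact Subtype.ext h1

/-- The index set `{r + 1 - i | i ∈ I}`. -/
def idxRev {k : ℕ} (I : Fin k ↪o Fin r) : Fin k ↪o Fin r :=
  OrderEmbedding.ofStrictMono (fun s => (I s.rev).rev) fun _ _ h =>
    Fin.rev_lt_rev.2 (I.strictMono (Fin.rev_lt_rev.2 h))

theorem IdxLE.idxRev {k : ℕ} {I J : Fin k ↪o Fin r} (h : IdxLE I J) :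
    IdxLE (idxRev J) (idxRev I) := fun s => Fin.rev_le_rev.2 (h s.rev)

theorem wt_idxRev {k : ℕ} (μ : Fin r → ℝ) (I : Fin k ↪o Fin r) :
    wt μ (idxRev I) = wt (hat μ) I :=
  Equiv.sum_comp Fin.revPerm fun s => μ (I s).rev

theorem hat_hat (μ : Fin r → ℝ) : hat (hat μ) = μ := by
  funext i
  rw [hat, hat, Fin.rev_rev]

theorem wt_hat_idxRev {k : ℕ} (μ : Fin r → ℝ) (I : Fin k ↪o Fin r) :
    wt (hat μ) (idxRev I) = wt μ I := by
  rw [wt_idxRev, hat_hat]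

/-- Transposition exchanges the two index sets; reversal lists them in decreasing order, and sorting
them changes only the sign. -/
theorem ord_minor_reflect {k : ℕ} (L : GL (Fin r) (ValRing K)) (I J : Fin k ↪o Fin r) :
    ord (minor (toF (reflect L)) I J) = ord (minor (toF L) (idxRev J) (idxRev I)) := by
  have e1 := ord_det_submatrix_perm_left (toF L) (fun s => (J s).rev) (idxRev I) Fin.revPerm
  have e2 := ord_det_submatrix_perm_right (toF L) (fun s => (J s).rev) (fun s => (I s).rev)
    Fin.revPerm
  rw [minor, minor, toF_reflect, ← Matrix.det_transpose]
  exact (e1.trans e2).symm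

/-- Reflection keeps the matrix lower triangular, exchanges rows with columns and reverses the order
of index sets. The row inequalities thus become the column inequalities, with the weights reversed.
-/
theorem MinorIneq.reflect {μ ν : Fin r → ℝ} {L : GL (Fin r) (ValRing K)}
    (h : MinorIneq μ ν L) : MinorIneq ν μ (reflect L) where
  lower := isLower_reflect h.lower
  row := fun k I H J h1 h2 => by
    rw [ord_minor_reflect, ord_minor_reflect]
    exact h.col k _ _ _ h2.idxRev h1.idxRev
  rowGap := fun k I H J h1 h2 => by
    rw [ord_minor_reflect, ord_minor_reflect, ← wt_hat_idxRev ν I, ← wt_hat_idxRev ν H]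
    exact h.colGap k _ _ _ h2.idxRev h1.idxRev
  col := fun k I H J h1 h2 => by
    rw [ord_minor_reflect, ord_minor_reflect]
    exact h.row k _ _ _ h2.idxRev h1.idxRev
  colGap := fun k I H J h1 h2 => by
    rw [ord_minor_reflect, ord_minor_reflect, ← wt_idxRev μ J, ← wt_idxRev μ H]
    exact h.rowGap k _ _ _ h2.idxRev h1.idxRev

theorem D_submatrix_rev (μ : Fin r → ℝ) :
    (D K μ).submatrix Fin.revPerm Fin.revPerm = D K (hat μ) := by
  rw [D, Matrix.submatrix_diagonal_equiv]
  rfl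

theorem D_transpose (μ : Fin r → ℝ) : (D K μ).transpose = D K μ := Matrix.diagonal_transpose _

/-- Transposing D_μ L D_ν̂ and reversing rows and columns yields the product for the reflected
matrix; neither operation changes the invariants. -/
theorem shape_reflect (μ ν : Fin r → ℝ) (L : GL (Fin r) (ValRing K)) :
    shape ν (reflect L) μ = shape μ L ν := by
  rw [shape, shape, ← inv_transpose (D K μ * toF L * D K (hat ν))]
  refine Eq.trans ?_ (inv_congr (matEquiv_submatrix Fin.revPerm Fin.revPerm _)).symm
  congr 1
  rw [Matrix.transpose_mul, Matrix.transpose_mul, D_transpose, D_transpose, ← mul_assoc,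
    ← Matrix.submatrix_mul_equiv _ _ _ Fin.revPerm _,
    ← Matrix.submatrix_mul_equiv _ _ _ Fin.revPerm _, D_submatrix_rev, D_submatrix_rev, hat_hat,
    toF_reflect]

theorem IsLeftFilling.isRightFilling_reflect {μ ν : Fin r → ℝ} {L : GL (Fin r) (ValRing K)}
    {m : Fin r → Fin r → ℝ} (h : IsLeftFilling (D K μ) (toF L * D K (hat ν)) m) :
    IsRightFilling (D K ν) (toF (reflect L) * D K (hat μ)) m := by
  obtain ⟨μ', N', A, hμ', ⟨P, Q, T, h1, h2⟩, hgen, hm⟩ := h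
  refine ⟨μ', N', A, hμ', ?_, hgen, hm⟩
  set w := glPerm K (Fin.revPerm (n := r)) with hw
  have hD : ∀ κ : Fin r → ℝ, toF w * D K κ * toF w⁻¹ = D K (hat κ) := fun κ => by
    rw [toF_glPerm_mul, mul_toF_glPerm_inv, Matrix.submatrix_submatrix]
    exact D_submatrix_rev κ
  have hL : toF (reflect L) = toF w * (toF L).transpose * toF w⁻¹ := by
    rw [reflect, toF_mul, toF_mul, toF_glTranspose]
  -- The transposed pair (D_ν̂ Lᵀ, D_μ) is equivalent to (D_ν, L' D_μ̂), with L' the reflection of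
  -- L: the reversal `w` undoes the hats, and the middle factor carries L' from one member to the
  -- other. The same generic matrix therefore serves both pairs.
  refine ⟨P * w⁻¹, Q * w⁻¹ * (reflect L)⁻¹, T * w⁻¹, ?_, ?_⟩
  · rw [h1, Matrix.transpose_mul, D_transpose, mul_inv_rev, mul_inv_rev, inv_inv, inv_inv,
      toF_mul, toF_mul, toF_mul, hL]
    have e : D K ν = toF w * D K (hat ν) * toF w⁻¹ := by rw [hD, hat_hat]
    rw [e]
    calc _ = toF P * 1 * D K (hat ν) * 1 * (toF L).transpose * 1 * toF Q⁻¹ := by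
          simp only [mul_one, mul_assoc]
      _ = _ := by
          rw [← toF_inv_mul w]
          simp only [mul_assoc]
  · rw [h2, D_transpose, ← hD, mul_inv_rev, inv_inv, toF_mul, toF_mul, toF_mul]
    symm
    calc _ = toF Q * (toF w⁻¹ * (toF (reflect L)⁻¹ * toF (reflect L)) * toF w) * D K μ *
          (toF w⁻¹ * toF w) * toF T⁻¹ := by simp only [mul_assoc]
      _ = _ := by simp only [toF_inv_mul, mul_one]

end LRFill

theorem mainTheorem4 {K : Type*} [Field K] [CharZero K] (r : ℕ) (μ ν : Fin r → ℝ)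
    (hμ : Antitone μ) (hν : Antitone ν) (L : GL (Fin r) (LRFill.ValRing K))
    (hL : LRFill.IsMuNuGeneric μ ν L) :
    (∀ k : Fin r → Fin r → ℝ,
      LRFill.IsRightFilling (LRFill.D K μ) (LRFill.toF L * LRFill.D K (LRFill.hat ν)) k →
      (∀ i j, i ≤ j → 0 ≤ k i j) →
      ∀ i : Fin r,
        (∀ j, LRFill.shape μ L (LRFill.beforeThen ν i (ν i)) j -
            LRFill.shape μ L (LRFill.before ν i) j = if i ≤ j then k i j else 0) ∧
        ∀ α β : ℝ, 0 < α → α < β → β ≤ ν i →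
          LRFill.IsHorizontalStrip (LRFill.shape μ L (LRFill.beforeThen ν i α))
            (LRFill.shape μ L (LRFill.before ν i)) ∧
          LRFill.IsHorizontalStrip (LRFill.shape μ L (LRFill.beforeThen ν i β))
            (LRFill.shape μ L (LRFill.before ν i)) ∧
          LRFill.IsInitialSegment (LRFill.shape μ L (LRFill.beforeThen ν i α))
            (LRFill.shape μ L (LRFill.beforeThen ν i β))
            (LRFill.shape μ L (LRFill.before ν i))) ∧
    (∀ m : Fin r → Fin r → ℝ,
      LRFill.IsLeftFilling (LRFill.D K μ) (LRFill.toF L * LRFill.D K (LRFill.hat ν)) m →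
      (∀ i j, i ≤ j → 0 ≤ m i j) →
      ∀ i : Fin r,
        (∀ j, LRFill.shape (LRFill.beforeThen μ i (μ i)) L ν j -
            LRFill.shape (LRFill.before μ i) L ν j = if i ≤ j then m i j else 0) ∧
        ∀ α β : ℝ, 0 < α → α < β → β ≤ μ i →
          LRFill.IsHorizontalStrip (LRFill.shape (LRFill.beforeThen μ i α) L ν)
            (LRFill.shape (LRFill.before μ i) L ν) ∧
          LRFill.IsHorizontalStrip (LRFill.shape (LRFill.beforeThen μ i β) L ν)
            (LRFill.shape (LRFill.before μ i) L ν) ∧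
          LRFill.IsInitialSegment (LRFill.shape (LRFill.beforeThen μ i α) L ν)
            (LRFill.shape (LRFill.beforeThen μ i β) L ν)
            (LRFill.shape (LRFill.before μ i) L ν)) := by
  have h := hL.minorIneq
  refine ⟨fun k hk hpos i => h.strips_of_rightFilling hμ hν hk hpos i, fun m hm hpos i => ?_⟩
  -- Part (a) for the reflected matrix, where the parts of μ are inserted on the right.
  have := h.reflect.strips_of_rightFilling hν hμ hm.isRightFilling_reflect hpos i
  simpa only [LRFill.shape_reflect] using this
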